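/- Let $n\ge 1$, let $B^n$ be the open unit ball of $\mathbb C^n$ and $S=\partial B^n$ its unit sphere. Let $\sigma$ be the normalized Lebesgue measure on $S$ and $V$ the Lebesgue measure on $\overline{B^n}$. For $x,y\in\overline{B^n}$ put $d(x,y)=|1-x\bar y|$, where $x\bar y=\sum_i x_i\overline{y_i}$, and for $E\subset S$ put $d(z,E)=\inf_{y\in E}d(z,y)$ (with $d(z,\emptyset)=+\infty$). In statements about $\sigma$, $B(x,R)=\{z\in S: d(z,x)<R\}$ and $E_\varepsilon=\{z\in S: d(z,E)<\varepsilon\}$; in statements about $V$, $B(x,R)$ and $E_\varepsilon$ are the corresponding subsets of $\overline{B^n}$. For $x\in E$, $R>0$, $k\ge1$, let $N(x,R,k)$ be the maximal number of points $t_i\in E$ with $d(t_i,x)<kR$ and $d(t_i,t_j)\ge R$ for $i\ne j$. The upper dimension $\Upsilon(E)$ is the infimum of all real $\gamma$ for which there is a $C>0$ with $N(x,R,k)\le Ck^\gamma$ for all $x\in E$ and $0<R\le kR\le 1$. Let $E\subset S$ be a closed set. Then the following statements are equivalent: (a) (Uniform Hole Condition) There is $0<C<1$ such that for all $x\in S$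 and all $0<r\le 2=\operatorname{diam}_d(S)$, $\sup\{d(y,E): y\in B(x,r)\}\ge Cr$. (b) There are $s<n$ and $C>0$ such that for all $x\in S$, $R>0$ and $0<\varepsilon<R$, $\sigma(B(x,R)\cap E_\varepsilon)\le CR^s\varepsilon^{n-s}$ (condition $\Sigma_s$). (c) $\Upsilon(E)<n$. (d) There are $a>0$ and $C>0$ such that for all $x\in S$ and $R>0$, $$\int_{B(x,R)}d(z,E)^{-a}\,d\sigma(z)\le CR^{n-a}.$$ (e) There is $C>0$ such that for all $x\in S$ and $R>0$, $$\int_{B(x,R)}\log\bigl(d(z,E)^{-1}\bigr)\,d\sigma(z)\le\sigma(B(x,R))\log\frac1R+CR^n.$$ (f) There are $0<a<n$ and $C>0$ such that for all $x\in E$ and $R>0$, $$\int_0^R N\Bigl(x,\delta,\frac R\delta\Bigr)\,\delta^{n-a}\,\frac{d\delta}\delta\le CR^{n-a}.$$ (g) There are $s<n$ and $C>0$ such that for all $x\in E$, $R>0$ and $0<\varepsilon<R$, $V(B(x,R)\cap E_\varepsilon)\le CR^s\varepsilon^{n+1-s}$. (h) There is $a_0>1$ such that for every $0\le a<a_0$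 there is $C>0$ such that for all $x\in S$ and $R>0$, $$\int_{B(x,R)}d(z,E)^{-a}\,dV(z)\le CR^{n+1-a}.$$ The integrands in (d), (e) and (h) (for $a>0$) take the value $+\infty$ on $E$. -/

import Mathlib

open MeasureTheory
open scoped ENNReal

namespace NonIso

noncomputable section

/-- `ℂⁿ` with its Hermitian (Euclidean) norm. -/
abbrev Cn (n : ℕ) : Type := EuclideanSpace ℂ (Fin n)

/-- The unit sphere `S = ∂Bⁿ` of `ℂⁿ`. -/
abbrev S (n : ℕ) : Set (Cn n) := Metric.sphere 0 1

/-- The closed unit ball of `ℂⁿ`. -/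
abbrev clB (n : ℕ) : Set (Cn n) := Metric.closedBall 0 1

/-- Normalized Lebesgue (surface) measure `σ` on the sphere, as a measure on `ℂⁿ` carried by `S`. -/
def sigma (n : ℕ) : Measure (Cn n) :=
  ((volume : Measure (Cn n)).toSphere Set.univ)⁻¹ •
    ((volume : Measure (Cn n)).toSphere.map Subtype.val)

/-- Lebesgue measure `V` on the closed unit ball. -/
def V (n : ℕ) : Measure (Cn n) := volume.restrict (clB n)

variable {n : ℕ}

/-- `d(x, y) = |1 - x ȳ|` with `x ȳ = ∑ i, x i * conj (y i)`
(Mathlib's inner product is conjugate-linear in its first argument). -/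
def nd (x y : Cn n) : ℝ := ‖1 - inner ℂ y x‖

/-- `d(z, E) = inf_{y ∈ E} d(z, y)`, equal to `∞` for `E = ∅`. -/
def ndSet (z : Cn n) (E : Set (Cn n)) : ℝ≥0∞ := ⨅ y ∈ E, ENNReal.ofReal (nd z y)

/-- The ball `B(x, R)` in the space `X`, where `X` is the sphere, the closed ball, or a subset. -/
def nball (X : Set (Cn n)) (x : Cn n) (R : ℝ) : Set (Cn n) := {z ∈ X | nd z x < R}

/-- The neighbourhood `E_ε = {z ∈ X : d(z, E) < ε}` of `E` in the space `X`. -/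
def nbhd (X E : Set (Cn n)) (ε : ℝ) : Set (Cn n) := {z ∈ X | ndSet z E < ENNReal.ofReal ε}

/-- `N(x, R, k)` for the space `(E, d)`: the largest number of points of `E` in `B(x, kR)` at
mutual distance at least `R`. -/
def packing (E : Set (Cn n)) (x : Cn n) (R k : ℝ) : ℕ∞ :=
  ⨆ (t : Finset (Cn n)) (_ : (t : Set (Cn n)) ⊆ nball E x (k * R))
    (_ : (t : Set (Cn n)).Pairwise fun y z => R ≤ nd y z), (t.card : ℕ∞)

/-- `(E, d) ∈ Υ_γ`. -/
def InUpsilon (E : Set (Cn n)) (γ : ℝ) : Prop :=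
  ∃ C : ℝ, 0 < C ∧ ∀ x ∈ E, ∀ R k : ℝ, 0 < R → R ≤ k * R → k * R ≤ 1 →
    (packing E x R k : ℝ≥0∞) ≤ ENNReal.ofReal (C * k ^ γ)

/-- The upper dimension `Υ(E) = inf {γ : (E, d) ∈ Υ_γ}`, an extended real number. -/
def upperDim (E : Set (Cn n)) : EReal := ⨅ (γ : ℝ) (_ : InUpsilon E γ), (γ : EReal)

/-- The Uniform Hole Condition with respect to `(S, d)`. Radii range up to `2`, the `d`-diameter
of `S`, since `d(y, E) ≤ 2` for `E ≠ ∅` rules the bound out for arbitrarily large radii. -/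
def UHC (E : Set (Cn n)) : Prop :=
  ∃ C : ℝ, 0 < C ∧ C < 1 ∧ ∀ x ∈ S n, ∀ r : ℝ, 0 < r → r ≤ 2 →
    ENNReal.ofReal (C * r) ≤ ⨆ y ∈ nball (S n) x r, ndSet y E

/-- The condition `Σ_s`. -/
def SigmaCond (E : Set (Cn n)) (s : ℝ) : Prop :=
  ∃ C : ℝ, 0 < C ∧ ∀ x ∈ S n, ∀ R ε : ℝ, 0 < ε → ε < R →
    sigma n (nball (S n) x R ∩ nbhd (S n) E ε) ≤ ENNReal.ofReal (C * R ^ s * ε ^ ((n : ℝ) - s))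

/-- The integral over `A` of an extended-real function: the integral of the positive part minus
the integral of the negative part. -/
def eintegral (μ : Measure (Cn n)) (A : Set (Cn n)) (f : Cn n → EReal) : EReal :=
  ((∫⁻ z in A, (f z).toENNReal ∂μ : ℝ≥0∞) : EReal) -
    ((∫⁻ z in A, (-f z).toENNReal ∂μ : ℝ≥0∞) : EReal)

/-- The bound `∫_{B(x,R)} d(z,E)^{-a} dσ(z) ≤ C R^{n-a}` for some `a > 0`. -/
def PowerIntegralBound (E : Set (Cn n)) : Prop :=
  ∃ a C : ℝ, 0 < a ∧ 0 < C ∧ ∀ x ∈ S n, ∀ R : ℝ, 0 < R →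
    ∫⁻ z in nball (S n) x R, ndSet z E ^ (-a) ∂(sigma n) ≤ ENNReal.ofReal (C * R ^ ((n : ℝ) - a))

/-- The bound `∫_{B(x,R)} log(d(z,E)⁻¹) dσ(z) ≤ σ(B(x,R)) log(1/R) + C Rⁿ`, where the integrand
is `+∞` on `E`. -/
def LogIntegralBound (E : Set (Cn n)) : Prop :=
  ∃ C : ℝ, 0 < C ∧ ∀ x ∈ S n, ∀ R : ℝ, 0 < R →
    eintegral (sigma n) (nball (S n) x R) (fun z => ENNReal.log (ndSet z E)⁻¹) ≤
      (((sigma n).real (nball (S n) x R) * Real.log (1 / R) + C * R ^ n : ℝ) : EReal)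

/-- The bound `∫_0^R N(x, δ, R/δ) δ^{n-a} dδ/δ ≤ C R^{n-a}` for some `0 < a < n`. -/
def PackingIntegralBound (E : Set (Cn n)) : Prop :=
  ∃ a C : ℝ, 0 < a ∧ a < n ∧ 0 < C ∧ ∀ x ∈ E, ∀ R : ℝ, 0 < R →
    ∫⁻ δ in Set.Ioo 0 R, (packing E x δ (R / δ) : ℝ≥0∞) * ENNReal.ofReal (δ ^ ((n : ℝ) - a) / δ) ≤
      ENNReal.ofReal (C * R ^ ((n : ℝ) - a))

/-- The volume bound `V(B(x,R) ∩ E_ε) ≤ C R^s ε^{n+1-s}` in the closed ball, for some `s < n`. -/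
def VolumeBound (E : Set (Cn n)) : Prop :=
  ∃ s C : ℝ, s < n ∧ 0 < C ∧ ∀ x ∈ E, ∀ R ε : ℝ, 0 < ε → ε < R →
    V n (nball (clB n) x R ∩ nbhd (clB n) E ε) ≤
      ENNReal.ofReal (C * R ^ s * ε ^ ((n : ℝ) + 1 - s))

/-- For some `a₀ > 1`, the bounds `∫_{B(x,R)} d(z,E)^{-a} dV(z) ≤ C(a) R^{n+1-a}` in the closed
ball, for all `0 ≤ a < a₀`. -/
def VolumeIntegralBound (E : Set (Cn n)) : Prop :=
  ∃ a₀ : ℝ, 1 < a₀ ∧ ∀ a : ℝ, 0 ≤ a → a < a₀ → ∃ C : ℝ, 0 < C ∧ ∀ x ∈ S n, ∀ R : ℝ, 0 < R →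
    ∫⁻ z in nball (clB n) x R, ndSet z E ^ (-a) ∂(V n) ≤
      ENNReal.ofReal (C * R ^ ((n : ℝ) + 1 - a))

end

end NonIso

open scoped Pointwise

namespace NonIso

variable {n : ℕ}

-- The function d is a quasi-metric on the closed ball. At the points of S, balls have mass
-- comparable to r^n for σ and to r^(n+1) for V (`regular_sigma`, `regular_V`). Every condition then
-- says that E is uniformly thinner than an n-dimensional set.
--
-- The hub is (c), a packing bound with exponent γ < n. Covering E_ε by balls around a net turns it
-- into bounds for the measure of E_ε (`measure_nbhd_le_of_packingBound`). Dyadic summation turns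
-- these into integrals of powers of d(z,E) (`lintegral_ndSet_rpow_le`), and log t ≤ t^a/a leads on
-- to the logarithmic integral. If a ball had no hole, log(1/d(z,E)) would be too large on all of
-- it, which closes the loop at (a). Conditions (f), (g) and (h) return to (c) by a single-scale
-- estimate, a volume count and Markov's inequality.
--
-- The deep step is (a) ⇒ (c). Near a δ-separated subset t of E ∩ B(x,R), the holes of each size r
-- in [δ,R] have total σ-measure at least a constant times |t|δ^n. Taken at J geometrically spaced
-- sizes they lie in disjoint shells inside one ball of mass O(R^n), so |t|(δ/R)^n = O(1/J). For J
-- large this improves the trivial count by a factor 2 at one fixed ratio of scales, and iterating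
-- over scales lowers the exponent below n.

-- Geometry of the quasi-metric d and measurability.

theorem nd_nonneg (x y : Cn n) : 0 ≤ nd x y := norm_nonneg _

theorem nd_comm (x y : Cn n) : nd x y = nd y x := by
  unfold nd
  rw [← RCLike.norm_conj]
  simp

theorem nd_self {x : Cn n} (hx : x ∈ S n) : nd x x = 0 := by
  have : ‖x‖ = 1 := by simpa using hx
  simp [nd, inner_self_eq_norm_sq_to_K, this]

theorem S_subset_clB : S n ⊆ clB n := Metric.sphere_subset_closedBall

theorem norm_inner_le_norm_of_mem_clB {x y : Cn n} (hx : x ∈ clB n) :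
    ‖inner ℂ y x‖ ≤ ‖y‖ := by
  have hx' : ‖x‖ ≤ 1 := by simpa using hx
  exact (norm_inner_le_norm y x).trans (mul_le_of_le_one_right (norm_nonneg _) hx')

theorem one_sub_norm_le_nd {x y : Cn n} (hx : x ∈ clB n) : 1 - ‖y‖ ≤ nd x y := by
  have h := norm_sub_norm_le (1 : ℂ) (inner ℂ y x)
  have h2 := norm_inner_le_norm_of_mem_clB (y := y) hx
  rw [norm_one] at h
  unfold nd
  linarith

theorem norm_sub_sq_le_nd {x y : Cn n} (hx : x ∈ clB n) (hy : y ∈ clB n) :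
    ‖x - y‖ ^ 2 ≤ 2 * nd x y := by
  have hx' : ‖x‖ ≤ 1 := by simpa using hx
  have hy' : ‖y‖ ≤ 1 := by simpa using hy
  have h := norm_sub_sq (𝕜 := ℂ) y x
  have h1 : 1 - RCLike.re (inner ℂ y x : ℂ) ≤ nd x y := by
    have := RCLike.re_le_norm (1 - inner ℂ y x : ℂ)
    simpa [nd] using this
  rw [norm_sub_rev] at h
  nlinarith [norm_nonneg x, norm_nonneg y]

/-- The quasi-triangle inequality on the closed ball. -/
theorem nd_triangle {x y z : Cn n} (hx : x ∈ clB n) (hy : y ∈ clB n) (hz : z ∈ clB n) :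
    nd x z ≤ 3 * (nd x y + nd y z) := by
  have hy' : ‖y‖ ≤ 1 := by simpa using hy
  -- Both error terms are controlled by d(x,y) + d(y,z): 1 - ‖y‖ is at most each summand, and ‖x -
  -- y‖² ≤ 2d(x,y), ‖z - y‖² ≤ 2d(y,z) feed Cauchy–Schwarz.
  have key : (1 : ℂ) - inner ℂ z x = (1 - inner ℂ y x) + (1 - inner ℂ z y) - (1 - inner ℂ y y)
      - inner ℂ (z - y) (x - y) := by
    simp only [inner_sub_left, inner_sub_right]; ring
  have h1 : ‖(1 : ℂ) - inner ℂ y y‖ ≤ nd x y + nd y z := by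
    have : (1 : ℂ) - inner ℂ y y = ((1 - ‖y‖ ^ 2 : ℝ) : ℂ) := by
      rw [inner_self_eq_norm_sq_to_K]; push_cast; rfl
    rw [this, Complex.norm_real, Real.norm_eq_abs, abs_of_nonneg (by nlinarith [norm_nonneg y])]
    have ha := one_sub_norm_le_nd (y := y) hx
    have hb := one_sub_norm_le_nd (y := y) hz
    rw [nd_comm z y] at hb
    nlinarith [norm_nonneg y]
  have h2 : ‖(inner ℂ (z - y) (x - y) : ℂ)‖ ≤ nd x y + nd y z := by
    have ha := norm_sub_sq_le_nd hx hy
    have hb := norm_sub_sq_le_nd hz hy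
    rw [nd_comm z y] at hb
    have := norm_inner_le_norm (𝕜 := ℂ) (z - y) (x - y)
    nlinarith [sq_nonneg (‖z - y‖ - ‖x - y‖)]
  have h3 : nd x z ≤ nd x y + nd y z + ‖(1 : ℂ) - inner ℂ y y‖ + ‖(inner ℂ (z - y) (x - y) : ℂ)‖ := by
    unfold nd
    rw [key]
    refine (norm_sub_le _ _).trans ?_
    gcongr
    refine (norm_sub_le _ _).trans ?_
    gcongr
    exact norm_add_le _ _
  linarith

@[fun_prop]
theorem continuous_nd_left (y : Cn n) : Continuous fun z => nd z y := by
  unfold nd; fun_prop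

/-- An infimum of continuous functions is upper semicontinuous, even over an uncountable family. -/
theorem measurable_ndSet (E : Set (Cn n)) : Measurable fun z => ndSet z E := by
  apply UpperSemicontinuous.measurable
  apply upperSemicontinuous_biInf
  intro y _
  exact (ENNReal.continuous_ofReal.comp (continuous_nd_left y)).upperSemicontinuous

theorem ndSet_lt_ofReal_iff {E : Set (Cn n)} {z : Cn n} {ε : ℝ} :
    ndSet z E < ENNReal.ofReal ε ↔ ∃ y ∈ E, nd z y < ε := by
  simp only [ndSet, iInf_lt_iff, exists_prop]
  refine exists_congr fun y => and_congr_right fun _ => ?_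
  rw [ENNReal.ofReal_lt_ofReal_iff_of_nonneg (nd_nonneg _ _)]

theorem ofReal_le_ndSet_iff {E : Set (Cn n)} {z : Cn n} {ε : ℝ} :
    ENNReal.ofReal ε ≤ ndSet z E ↔ ∀ y ∈ E, ε ≤ nd z y := by
  rw [← not_lt, ndSet_lt_ofReal_iff]; push Not; rfl

theorem measurableSet_nball {X : Set (Cn n)} (hX : MeasurableSet X) (x : Cn n) (R : ℝ) :
    MeasurableSet (nball X x R) :=
  hX.inter ((continuous_nd_left x).measurable measurableSet_Iio)

theorem measurableSet_nbhd {X : Set (Cn n)} (hX : MeasurableSet X) (E : Set (Cn n)) (ε : ℝ) :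
    MeasurableSet (nbhd X E ε) :=
  hX.inter (measurable_ndSet E measurableSet_Iio)

theorem measurableSet_S : MeasurableSet (S n) := Metric.isClosed_sphere.measurableSet

theorem measurableSet_clB : MeasurableSet (clB n) := Metric.isClosed_closedBall.measurableSet

-- Regularity of Lebesgue measure on the closed ball.

/-- `(X, d, μ)` is `m`-regular at the points of the sphere. -/
def Regular (X : Set (Cn n)) (μ : Measure (Cn n)) (m : ℝ) : Prop :=
  ∃ c C : ℝ, 0 < c ∧ 0 < C ∧
    (∀ x ∈ S n, ∀ r : ℝ, 0 < r → r ≤ 2 → ENNReal.ofReal (c * r ^ m) ≤ μ (nball X x r)) ∧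
    (∀ x ∈ S n, ∀ r : ℝ, 0 < r → μ (nball X x r) ≤ ENNReal.ofReal (C * r ^ m))

/-- Haar measures on the Euclidean and the product space agree up to a factor, whose value is
irrelevant to regularity. -/
theorem exists_volume_polydisc (n : ℕ) : ∃ c : ℝ, 0 < c ∧ ∀ (w : Fin n → ℂ) (r : Fin n → ℝ),
    (∀ i, 0 ≤ r i) →
    (volume : Measure (Cn n)) {z | ∀ i, ‖z i - w i‖ < r i} = ENNReal.ofReal (c * ∏ i, r i ^ 2) := by
  let L := (PiLp.continuousLinearEquiv 2 ℝ (fun _ : Fin n => ℂ)).symm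
  let ν : Measure (Cn n) := (volume : Measure (Fin n → ℂ)).map L
  have : ν.IsAddHaarMeasure := L.isAddHaarMeasure_map _
  obtain ⟨c, hc⟩ : ∃ c : NNReal, (volume : Measure (Cn n)) = c • ν :=
    ⟨_, Measure.isAddLeftInvariant_eq_smul _ _⟩
  have hc0 : c ≠ 0 := by
    rintro rfl
    rw [zero_smul] at hc
    exact NeZero.ne (volume : Measure (Cn n)) hc
  refine ⟨c * Real.pi ^ n, by positivity, fun w r hr => ?_⟩
  have h1 : ν {z | ∀ i, ‖z i - w i‖ < r i} = ENNReal.ofReal (Real.pi ^ n * ∏ i, r i ^ 2) := by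
    have hpre : L ⁻¹' {z : Cn n | ∀ i, ‖z i - w i‖ < r i} =
        Set.univ.pi fun i => Metric.ball (w i) (r i) := by
      ext z
      simp [L, Set.mem_pi, dist_eq_norm]
    have hm : MeasurableSet {z : Cn n | ∀ i, ‖z i - w i‖ < r i} := by
      refine IsOpen.measurableSet ?_
      simp only [Set.ofPred_forall]
      refine isOpen_iInter_of_finite fun i => ?_
      exact isOpen_lt (by fun_prop) (by fun_prop)
    rw [Measure.map_apply L.continuous.measurable hm, hpre, volume_pi_pi]
    simp only [Complex.volume_ball]
    rw [Finset.prod_mul_distrib, Finset.prod_const, Finset.card_fin, mul_comm,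
      ENNReal.ofReal_mul (by positivity), ENNReal.ofReal_prod_of_nonneg (fun i _ => by positivity),
      ENNReal.ofReal_pow Real.pi_pos.le]
    congr 1
    · congr 1
      rw [ENNReal.ofReal, Real.toNNReal_of_nonneg Real.pi_pos.le]
      rfl
    · exact Finset.prod_congr rfl fun i _ => (ENNReal.ofReal_pow (hr i) 2).symm
  rw [hc, Measure.smul_apply, h1, mul_assoc, ENNReal.ofReal_mul (p := (c : ℝ)) c.2,
    ENNReal.smul_def, smul_eq_mul, ENNReal.ofReal_coe_nnreal]

theorem measurePreserving_complexIsometry (U : Cn n ≃ₗᵢ[ℂ] Cn n) :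
    MeasurePreserving U volume volume :=
  (LinearIsometryEquiv.measurePreserving
    { U.toLinearEquiv.restrictScalars ℝ with norm_map' := U.norm_map } :)

theorem exists_isometry_inner_eq_coord {m : ℕ} {x : Cn (m + 1)} (hx : x ∈ S (m + 1)) :
    ∃ U : Cn (m + 1) ≃ₗᵢ[ℂ] Cn (m + 1), ∀ z, inner ℂ x z = U z 0 := by
  have hx' : ‖x‖ = 1 := by simpa using hx
  have ho : Orthonormal ℂ (({0} : Set (Fin (m + 1))).domRestrict fun _ => x) := by
    rw [orthonormal_iff_ite]
    rintro ⟨i, hi⟩ ⟨j, hj⟩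
    obtain rfl : i = 0 := hi
    obtain rfl : j = 0 := hj
    simp [inner_self_eq_norm_sq_to_K, hx']
  obtain ⟨b, hb⟩ := ho.exists_orthonormalBasis_extension_of_card_eq (by simp)
  refine ⟨b.repr, fun z => ?_⟩
  rw [b.repr_apply_apply, hb 0 rfl]

/-- A unitary map turns the inner product with x into the first coordinate, so that d(z,x) becomes
|1 - z₀|. -/
theorem V_nball_eq {m : ℕ} {x : Cn (m + 1)} (hx : x ∈ S (m + 1)) (R : ℝ) :
    V (m + 1) (nball (clB (m + 1)) x R) =
      (volume : Measure (Cn (m + 1))) {z | ‖z‖ ≤ 1 ∧ ‖1 - z 0‖ < R} := by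
  obtain ⟨U, hU⟩ := exists_isometry_inner_eq_coord hx
  have hm : MeasurableSet {z : Cn (m + 1) | ‖z‖ ≤ 1 ∧ ‖1 - z 0‖ < R} := by
    have h1 : MeasurableSet {z : Cn (m + 1) | ‖z‖ ≤ 1} :=
      measurableSet_le (by fun_prop) (by fun_prop)
    have h2 : IsOpen {z : Cn (m + 1) | ‖1 - z 0‖ < R} := isOpen_lt (by fun_prop) (by fun_prop)
    exact h1.inter h2.measurableSet
  rw [V, Measure.restrict_eq_self _ fun z hz => hz.1,
    ← (measurePreserving_complexIsometry U).measure_preimage hm.nullMeasurableSet]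
  congr 1
  ext z
  simp [nball, nd, hU]

/-- The ball at e₀ is squeezed between polydiscs with one radius of order r and the other n - 1 of
order √r, of volume r² · r^(n-1). -/
theorem regular_V (hn : 1 ≤ n) : Regular (clB n) (V n) (n + 1) := by
  obtain ⟨m, rfl⟩ : ∃ m, n = m + 1 := ⟨n - 1, by omega⟩
  obtain ⟨c, hc, hvol⟩ := exists_volume_polydisc (m + 1)
  refine ⟨c * (1 / 64 * (1 / (8 * (m + 1) ^ 2)) ^ m), c * 2 ^ m, by positivity, by positivity,
    fun x hx r hr hr2 => ?_, fun x hx r hr => ?_⟩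
  · rw [V_nball_eq hx]
    -- This radius makes the m small coordinates contribute at most r/8 to ‖z‖², which fits into the
    -- room left by ‖z 0‖ ≤ 1 - r/8.
    set b : ℝ := Real.sqrt (r / 2) / (2 * (m + 1)) with hb
    have hb2 : b ^ 2 = r / (8 * (m + 1) ^ 2) := by
      rw [hb, div_pow, Real.sq_sqrt (by positivity)]; field_simp; norm_num
    have h := hvol (Fin.cons ((1 - r / 4 : ℝ) : ℂ) fun _ => 0) (Fin.cons (r / 8) fun _ => b)
      (Fin.cases (by simp; positivity) fun i => by simp; positivity)
    rw [Fin.prod_univ_succ] at h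
    simp only [Fin.cons_zero, Fin.cons_succ, Finset.prod_const, Finset.card_fin, hb2] at h
    have e : c * (1 / 64 * (1 / (8 * ((m : ℝ) + 1) ^ 2)) ^ m) * r ^ (((m + 1 : ℕ) : ℝ) + 1) =
        c * ((r / 8) ^ 2 * (r / (8 * ((m : ℝ) + 1) ^ 2)) ^ m) := by
      have : (((m + 1 : ℕ) : ℝ) + 1) = ((m + 2 : ℕ) : ℝ) := by push_cast; ring
      rw [this, Real.rpow_natCast, div_pow r (8 * ((m : ℝ) + 1) ^ 2), div_pow 1, one_pow]
      ring
    rw [e, ← h]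
    refine measure_mono fun z hz => ?_
    have h0 : ‖z 0 - ((1 - r / 4 : ℝ) : ℂ)‖ < r / 8 := by simpa using hz 0
    have hi : ∀ i : Fin m, ‖z i.succ‖ ^ 2 ≤ r / (8 * (m + 1) ^ 2) := fun i => by
      have : ‖z i.succ‖ < b := by simpa using hz i.succ
      rw [← hb2]
      gcongr
    have hsum : ∑ i : Fin m, ‖z i.succ‖ ^ 2 ≤ r / 8 := by
      refine (Finset.sum_le_sum fun i _ => hi i).trans ?_
      rw [Finset.sum_const, Finset.card_fin, nsmul_eq_mul, mul_div_assoc',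
        div_le_div_iff₀ (by positivity) (by norm_num)]
      have : (m : ℝ) ≤ (m + 1) ^ 2 := by nlinarith [(Nat.cast_nonneg m : (0:ℝ) ≤ m)]
      nlinarith
    have hz0 : ‖z 0‖ ≤ 1 - r / 8 := by
      have := norm_sub_norm_le (z 0) ((1 - r / 4 : ℝ) : ℂ)
      rw [Complex.norm_real, Real.norm_eq_abs, abs_of_nonneg (by linarith)] at this
      linarith
    constructor
    · have := EuclideanSpace.norm_sq_eq z
      rw [Fin.sum_univ_succ] at this
      nlinarith [norm_nonneg z, norm_nonneg (z 0)]
    · have : (1 : ℂ) - z 0 = ((r / 4 : ℝ) : ℂ) - (z 0 - ((1 - r / 4 : ℝ) : ℂ)) := by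
        push_cast; ring
      rw [this]
      refine (norm_sub_le _ _).trans_lt ?_
      rw [Complex.norm_real, Real.norm_eq_abs, abs_of_nonneg (by linarith)]
      linarith
  · rw [V_nball_eq hx]
    have h := hvol (Fin.cons 1 fun _ => 0) (Fin.cons r fun _ => Real.sqrt (2 * r))
      (Fin.cases (by simpa using hr.le) fun i => by simp)
    rw [Fin.prod_univ_succ] at h
    simp only [Fin.cons_zero, Fin.cons_succ, Finset.prod_const, Finset.card_fin] at h
    rw [Real.sq_sqrt (by positivity)] at h
    have e : c * 2 ^ m * r ^ (((m + 1 : ℕ) : ℝ) + 1) = c * (r ^ 2 * (2 * r) ^ m) := by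
      have : (((m + 1 : ℕ) : ℝ) + 1) = ((m + 2 : ℕ) : ℝ) := by push_cast; ring
      rw [this, Real.rpow_natCast]
      ring
    rw [e, ← h]
    refine measure_mono fun z hz => ?_
    obtain ⟨hz1, hz2⟩ := hz
    -- Hence the remaining coordinates satisfy ∑|zᵢ|² ≤ 1 - |z₀|² < 2r.
    have h0 : 1 - ‖z 0‖ < r := by
      have := norm_sub_norm_le 1 (z 0)
      rw [norm_one] at this
      linarith
    have hsq := EuclideanSpace.norm_sq_eq z
    rw [Fin.sum_univ_succ] at hsq
    have hs : ∀ i : Fin m, ‖z i.succ‖ ^ 2 ≤ ∑ i : Fin m, ‖z i.succ‖ ^ 2 := fun i =>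
      Finset.single_le_sum (f := fun i : Fin m => ‖z i.succ‖ ^ 2) (fun _ _ => by positivity)
        (Finset.mem_univ i)
    have hle : ‖z 0‖ ≤ 1 := (PiLp.norm_apply_le z 0).trans hz1
    intro i
    refine Fin.cases ?_ (fun i => ?_) i
    · simpa [norm_sub_rev] using hz2
    · simp only [Fin.cons_succ, sub_zero]
      apply Real.lt_sqrt_of_sq_lt
      have := hs i
      nlinarith [norm_nonneg z, norm_nonneg (z 0)]

-- Regularity of surface measure, through volumes of cones.

/-- The truncated cone `{rζ : ζ ∈ A, 0 < r < t}` over a set `A` of unit vectors. -/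
def truncCone (A : Set (Cn n)) (t : ℝ) : Set (Cn n) := {z | 0 < ‖z‖ ∧ ‖z‖ < t ∧ ‖z‖⁻¹ • z ∈ A}

theorem measurableSet_truncCone {A : Set (Cn n)} (hA : MeasurableSet A) (t : ℝ) :
    MeasurableSet (truncCone A t) := by
  have h1 : Measurable fun z : Cn n => ‖z‖⁻¹ • z := by fun_prop
  have h2 : Measurable fun z : Cn n => ‖z‖ := by fun_prop
  exact (h2 measurableSet_Ioi).inter ((h2 measurableSet_Iio).inter (h1 hA))

theorem volume_truncCone (A : Set (Cn n)) {t : ℝ} (ht : 0 < t) :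
    volume (truncCone A t) = ENNReal.ofReal (t ^ (2 * n)) * volume (truncCone A 1) := by
  have h : truncCone A t = t • truncCone A 1 := by
    ext z
    rw [Set.mem_smul_set_iff_inv_smul_mem₀ ht.ne']
    simp only [truncCone, Set.mem_ofPred_eq, norm_smul, norm_inv, Real.norm_eq_abs, abs_of_pos ht,
      smul_smul]
    rw [inv_mul_lt_iff₀ ht, mul_one]
    have e : (t⁻¹ * ‖z‖)⁻¹ * t⁻¹ = ‖z‖⁻¹ := by
      rw [mul_inv, inv_inv, mul_right_comm, mul_inv_cancel₀ ht.ne', one_mul]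
    rw [e]
    have : 0 < t⁻¹ * ‖z‖ ↔ 0 < ‖z‖ := by
      rw [mul_pos_iff_of_pos_left (inv_pos.mpr ht)]
    rw [this]
  have hf : Module.finrank ℝ (Cn n) = 2 * n := by
    rw [← Module.finrank_mul_finrank ℝ ℂ (Cn n)]
    simp
  rw [h, Measure.addHaar_smul, hf, abs_of_nonneg (by positivity)]

theorem volume_truncCone_ne_top (A : Set (Cn n)) : volume (truncCone A 1) ≠ ∞ :=
  ((measure_mono fun z (hz : z ∈ truncCone A 1) => mem_ball_zero_iff.mpr hz.2.1).trans_lt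
    measure_ball_lt_top).ne

theorem sigma_apply (hn : 1 ≤ n) {A : Set (Cn n)} (hA : MeasurableSet A) (hAS : A ⊆ S n) :
    sigma n A = (volume (Metric.ball (0 : Cn n) 1))⁻¹ * volume (truncCone A 1) := by
  have hcone : Set.Ioo (0 : ℝ) 1 • (Subtype.val '' ((Subtype.val : S n → Cn n) ⁻¹' A)) =
      truncCone A 1 := by
    rw [Subtype.image_preimage_coe, Set.inter_eq_right.mpr hAS]
    ext z
    rw [Set.mem_smul]
    constructor
    · rintro ⟨r, hr, y, hy, rfl⟩
      have hy1 : ‖y‖ = 1 := by simpa using hAS hy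
      have : ‖r • y‖ = r := by rw [norm_smul, hy1, Real.norm_eq_abs, abs_of_pos hr.1, mul_one]
      refine ⟨by rw [this]; exact hr.1, by rw [this]; exact hr.2, ?_⟩
      rw [this, smul_smul, inv_mul_cancel₀ hr.1.ne', one_smul]
      exact hy
    · rintro ⟨h1, h2, h3⟩
      refine ⟨‖z‖, ⟨h1, h2⟩, _, h3, ?_⟩
      rw [smul_smul, mul_inv_cancel₀ h1.ne', one_smul]
  have hf : Module.finrank ℝ (Cn n) ≠ 0 := by
    rw [← Module.finrank_mul_finrank ℝ ℂ (Cn n)]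
    simp
    omega
  rw [sigma, Measure.smul_apply, Measure.map_apply measurable_subtype_coe hA,
    Measure.toSphere_apply' _ (measurable_subtype_coe hA), Measure.toSphere_apply_univ, hcone,
    smul_eq_mul, ENNReal.mul_inv (Or.inl (by exact_mod_cast hf)) (Or.inl (by simp))]
  rw [mul_mul_mul_comm, ENNReal.inv_mul_cancel (by exact_mod_cast hf) (by simp), one_mul]

theorem sigma_eq_ofReal (hn : 1 ≤ n) {A : Set (Cn n)} (hA : MeasurableSet A) (hAS : A ⊆ S n) :
    sigma n A = ENNReal.ofReal
      ((volume (truncCone A 1)).toReal / (volume (Metric.ball (0 : Cn n) 1)).toReal) := by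
  rw [sigma_apply hn hA hAS, ← ENNReal.toReal_div, ENNReal.ofReal_toReal, mul_comm, div_eq_mul_inv]
  exact ENNReal.div_ne_top (volume_truncCone_ne_top A) (Metric.measure_ball_pos _ _ one_pos).ne'

/-- A conical layer of thickness 1 - t has volume of order (1 - t) times the measure of its base;
this converts V-estimates into σ-estimates. -/
theorem volume_truncCone_sdiff {A : Set (Cn n)} (hA : MeasurableSet A) {t : ℝ} (ht : 0 < t)
    (ht1 : t ≤ 1) :
    volume (truncCone A 1 \ truncCone A t) =
      ENNReal.ofReal ((1 - t ^ (2 * n)) * (volume (truncCone A 1)).toReal) := by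
  have hsub : truncCone A t ⊆ truncCone A 1 := fun z hz => ⟨hz.1, hz.2.1.trans_le ht1, hz.2.2⟩
  have hfin := volume_truncCone_ne_top A
  rw [measure_sdiff hsub (measurableSet_truncCone hA t).nullMeasurableSet
    ((measure_mono hsub).trans_lt hfin.lt_top).ne, volume_truncCone A ht, sub_mul, one_mul,
    ENNReal.ofReal_sub _ (by positivity), ENNReal.ofReal_mul (by positivity),
    ENNReal.ofReal_toReal hfin]

theorem nd_smul_le_add {x y : Cn n} (hx : x ∈ S n) (hy : y ∈ S n) {ρ : ℝ} (hρ1 : ρ ≤ 1) :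
    nd (ρ • y) x ≤ nd y x + (1 - ρ) := by
  have h1 := norm_inner_le_norm_of_mem_clB (y := x) (S_subset_clB hy)
  have hx' : ‖x‖ = 1 := by simpa using hx
  have e : (1 : ℂ) - inner ℂ x (ρ • y) = (1 - inner ℂ x y) + ((1 - ρ : ℝ) : ℂ) * inner ℂ x y := by
    rw [inner_smul_right_eq_smul, Complex.real_smul]; push_cast; ring
  unfold nd
  rw [e]
  refine (norm_add_le _ _).trans ?_
  rw [norm_mul, Complex.norm_real, Real.norm_eq_abs, abs_of_nonneg (by linarith)]
  nlinarith

theorem nd_le_two_mul_nd_smul {x y : Cn n} (hx : x ∈ S n) (hy : y ∈ S n) {ρ : ℝ} (hρ : 0 ≤ ρ)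
    (hρ1 : ρ ≤ 1) : nd y x ≤ 2 * nd (ρ • y) x := by
  have h1 := norm_inner_le_norm_of_mem_clB (y := x) (S_subset_clB hy)
  have hx' : ‖x‖ = 1 := by simpa using hx
  have hy' : ‖y‖ = 1 := by simpa using hy
  have h2 : 1 - ρ ≤ nd (ρ • y) x := by
    have := one_sub_norm_le_nd (x := x) (y := ρ • y) (S_subset_clB hx)
    rwa [norm_smul, hy', Real.norm_eq_abs, abs_of_nonneg hρ, mul_one, nd_comm] at this
  have e : (1 : ℂ) - inner ℂ x y = (1 - inner ℂ x (ρ • y)) - ((1 - ρ : ℝ) : ℂ) * inner ℂ x y := by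
    rw [inner_smul_right_eq_smul, Complex.real_smul]; push_cast; ring
  have h3 : nd y x ≤ nd (ρ • y) x + (1 - ρ) * 1 := by
    unfold nd
    rw [e]
    refine (norm_sub_le _ _).trans ?_
    rw [norm_mul, Complex.norm_real, Real.norm_eq_abs, abs_of_nonneg (by linarith)]
    gcongr
    linarith
  linarith

/-- The conical layer of thickness comparable to r over a spherical ball of radius r is comparable
to a solid ball, of volume r^(n+1). Dividing by the thickness leaves r^n. -/
theorem regular_sigma (hn : 1 ≤ n) : Regular (S n) (sigma n) n := by
  obtain ⟨c, C, hc, hC, hlow, hup⟩ := regular_V hn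
  set β := (volume (Metric.ball (0 : Cn n) 1)).toReal with hβ
  have hβ0 : 0 < β := ENNReal.toReal_pos (Metric.measure_ball_pos _ _ one_pos).ne'
    measure_ball_lt_top.ne
  have hn' : (1 : ℝ) ≤ n := by exact_mod_cast hn
  refine ⟨c / (2 * n) / 4 ^ n / β, C * 2 ^ (n + 1) / β + 1, by positivity, by positivity,
    fun x hx r hr hr2 => ?_, fun x hx r hr => ?_⟩
  all_goals
    have hm := measurableSet_nball measurableSet_S x r
    rw [sigma_eq_ofReal hn hm fun z hz => hz.1, Real.rpow_natCast]
    set q := (volume (truncCone (nball (S n) x r) 1)).toReal with hq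
    have hq0 : 0 ≤ q := ENNReal.toReal_nonneg
    apply ENNReal.ofReal_le_ofReal
  · have hsub : nball (clB n) x (r / 4) ⊆ (truncCone (nball (S n) x r) 1 \
        truncCone (nball (S n) x r) (1 - r / 4)) ∪ Metric.sphere 0 1 := by
      rintro z ⟨hz, hzx⟩
      have hz1 : ‖z‖ ≤ 1 := by simpa using hz
      rcases hz1.lt_or_eq with hz1 | hz1
      · have h1 : 1 - r / 4 < ‖z‖ := by
          have := one_sub_norm_le_nd (x := x) (y := z) (S_subset_clB hx)
          rw [nd_comm] at this
          linarith
        have hz0 : 0 < ‖z‖ := by linarith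
        have hS : ‖z‖⁻¹ • z ∈ S n := by
          simp [norm_smul, inv_mul_cancel₀ hz0.ne']
        have e : ‖z‖ • (‖z‖⁻¹ • z) = z := by rw [smul_smul, mul_inv_cancel₀ hz0.ne', one_smul]
        have h2 := nd_le_two_mul_nd_smul hx hS (norm_nonneg z) hz1.le
        rw [e] at h2
        exact Or.inl ⟨⟨hz0, hz1, hS, by linarith⟩, fun h => absurd h.2.1 (not_lt.mpr h1.le)⟩
      · exact Or.inr (by simpa using hz1)
    have h := ((hlow x hx (r / 4) (by linarith) (by linarith)).trans_eq
      (Measure.restrict_eq_self volume fun z hz => hz.1)).trans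
      ((measure_mono hsub).trans (measure_union_le _ _))
    have : Nontrivial (Cn n) := by
      have : Nonempty (Fin n) := ⟨⟨0, hn⟩⟩
      infer_instance
    rw [Measure.addHaar_sphere, add_zero, volume_truncCone_sdiff hm (by linarith) (by linarith),
      ENNReal.ofReal_le_ofReal_iff'] at h
    have e : (r / 4) ^ ((n : ℝ) + 1) = r ^ n / 4 ^ n * (r / 4) := by
      rw [← Nat.cast_succ, Real.rpow_natCast, pow_succ, div_pow]
    -- Bernoulli bounds the layer factor 1 - (1 - r/4)^(2n) by 2n · r/4.
    have hb := one_add_mul_le_pow (a := -(r / 4)) (by linarith) (2 * n)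
    rw [← sub_eq_add_neg] at hb
    push_cast at hb
    rcases h with h | h
    · have h2 : c * (r ^ n / 4 ^ n) * (r / 4) ≤ 2 * n * q * (r / 4) := by
        rw [mul_assoc, ← e]
        refine h.trans ?_
        have : 1 - (1 - r / 4) ^ (2 * n) ≤ 2 * n * (r / 4) := by linarith
        nlinarith
      have h3 := le_of_mul_le_mul_right h2 (by linarith)
      rw [div_mul_eq_mul_div]
      gcongr
      rw [div_div, div_mul_eq_mul_div, div_le_iff₀ (by positivity)]
      rw [mul_div_assoc', div_le_iff₀ (by positivity)] at h3
      linarith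
    · have : 0 < c * (r / 4) ^ ((n : ℝ) + 1) := by positivity
      linarith
  -- For r ≥ 1 the layer argument is replaced by σ(S) = 1; this accounts for the summand 1 in the
  -- constant.
  · rcases lt_or_ge r 1 with h1 | h1
    · have hsub : truncCone (nball (S n) x r) 1 \ truncCone (nball (S n) x r) (1 - r) ⊆
          nball (clB n) x (2 * r) := by
        rintro z ⟨⟨hz0, hz1, hzA⟩, hz2⟩
        have hzr : 1 - r ≤ ‖z‖ := by
          by_contra h
          exact hz2 ⟨hz0, not_le.mp h, hzA⟩
        refine ⟨by simpa using hz1.le, ?_⟩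
        have e : z = ‖z‖ • (‖z‖⁻¹ • z) := by rw [smul_smul, mul_inv_cancel₀ hz0.ne', one_smul]
        have := nd_smul_le_add hx hzA.1 hz1.le
        rw [← e] at this
        linarith [hzA.2]
      have h := (measure_mono hsub).trans_eq
        (Measure.restrict_eq_self volume (fun z hz => hz.1 : nball (clB n) x (2 * r) ⊆ clB n)).symm
      rw [volume_truncCone_sdiff hm (by linarith) (by linarith)] at h
      have h' := h.trans (hup x hx (2 * r) (by linarith))
      rw [ENNReal.ofReal_le_ofReal_iff (by positivity)] at h'
      have hpow : (1 - r) ^ (2 * n) ≤ 1 - r :=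
        pow_le_of_le_one (by linarith) (by linarith) (by omega)
      have e : (2 * r) ^ ((n : ℝ) + 1) = 2 ^ (n + 1) * r ^ n * r := by
        rw [← Nat.cast_succ, Real.rpow_natCast, Nat.succ_eq_add_one]; ring
      have h2 : r * q ≤ r * (C * 2 ^ (n + 1) * r ^ n) := by
        calc r * q ≤ (1 - (1 - r) ^ (2 * n)) * q := by gcongr; linarith
          _ ≤ _ := h'
          _ = _ := by rw [e]; ring
      have h3 := le_of_mul_le_mul_left h2 hr
      rw [add_mul, div_mul_eq_mul_div]
      have : q / β ≤ C * 2 ^ (n + 1) * r ^ n / β := by gcongr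
      have : 0 < 1 * r ^ n := by positivity
      linarith
    · have : q ≤ β := ENNReal.toReal_mono measure_ball_lt_top.ne
        (measure_mono fun z hz => mem_ball_zero_iff.mpr hz.2.1)
      have h2 : q / β ≤ 1 := (div_le_one hβ0).mpr this
      have h3 : 1 ≤ r ^ n := one_le_pow₀ h1
      have h4 : 0 < C * 2 ^ (n + 1) / β := by positivity
      nlinarith

-- Separated sets, nets and packing numbers.

/-- The points of `t` are at mutual distance at least `δ`. -/
def Separated (δ : ℝ) (t : Finset (Cn n)) : Prop :=
  (t : Set (Cn n)).Pairwise fun y z => δ ≤ nd y z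

theorem Separated.mono {δ : ℝ} {s t : Finset (Cn n)} (h : Separated δ t) (hst : s ⊆ t) :
    Separated δ s := Set.Pairwise.mono (Finset.coe_subset.mpr hst) h

theorem Separated.anti {δ δ' : ℝ} {t : Finset (Cn n)} (h : Separated δ t) (hδ : δ' ≤ δ) :
    Separated δ' t := fun _ hy _ hz hyz => hδ.trans (h hy hz hyz)

/-- A bound for the number of `δ`-separated points of `E` in balls of radius `R`, at all scales. -/
def PackingBound (E : Set (Cn n)) (γ C : ℝ) : Prop :=
  ∀ x ∈ E, ∀ δ R : ℝ, 0 < δ → δ ≤ R → ∀ t : Finset (Cn n), (t : Set (Cn n)) ⊆ nball E x R →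
    Separated δ t → (t.card : ℝ) ≤ C * (R / δ) ^ γ

theorem card_le_packing {E : Set (Cn n)} {x : Cn n} {δ k : ℝ} {t : Finset (Cn n)}
    (ht : (t : Set (Cn n)) ⊆ nball E x (k * δ)) (hs : Separated δ t) :
    (t.card : ℝ≥0∞) ≤ (packing E x δ k : ℝ≥0∞) := by
  have : (t.card : ℕ∞) ≤ packing E x δ k :=
    le_iSup_of_le t (le_iSup_of_le ht (le_iSup_of_le hs le_rfl))
  exact_mod_cast (ENat.toENNReal_le.mpr this)

theorem packing_le_ofReal {E : Set (Cn n)} {x : Cn n} {δ k B : ℝ} (hB : 0 ≤ B)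
    (h : ∀ t : Finset (Cn n), (t : Set (Cn n)) ⊆ nball E x (k * δ) → Separated δ t →
      (t.card : ℝ) ≤ B) : (packing E x δ k : ℝ≥0∞) ≤ ENNReal.ofReal B := by
  have h1 : packing E x δ k ≤ (⌊B⌋₊ : ℕ∞) := by
    refine iSup_le fun t => iSup_le fun ht => iSup_le fun hs => ?_
    exact_mod_cast Nat.le_floor (h t ht hs)
  refine (ENat.toENNReal_le.mpr h1).trans ?_
  rw [ENat.toENNReal_coe, ← ENNReal.ofReal_natCast]
  exact ENNReal.ofReal_le_ofReal (Nat.floor_le hB)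

/-- A separated set of greatest cardinality is a net, since a point far from it could be added; `hM`
ensures that a greatest one exists. -/
theorem exists_maximal_separated {A : Set (Cn n)} (hA : A ⊆ S n) {δ : ℝ} (hδ : 0 < δ) {M : ℕ}
    (hM : ∀ t : Finset (Cn n), (t : Set (Cn n)) ⊆ A → Separated δ t → t.card ≤ M) :
    ∃ F : Finset (Cn n), (F : Set (Cn n)) ⊆ A ∧ Separated δ F ∧ ∀ a ∈ A, ∃ f ∈ F, nd a f < δ := by
  classical
  let P : ℕ → Prop := fun k => ∃ t : Finset (Cn n), (t : Set (Cn n)) ⊆ A ∧ Separated δ t ∧ t.card = k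
  have hP0 : P 0 := ⟨∅, by simp, by simp [Separated], rfl⟩
  obtain ⟨F, hFA, hFs, hFc⟩ := Nat.findGreatest_spec (P := P) (Nat.zero_le M) hP0
  refine ⟨F, hFA, hFs, fun a ha => ?_⟩
  by_contra! hcon
  have haF : a ∉ F := fun h => by
    have := hcon a h
    rw [nd_self (hA ha)] at this
    linarith
  have hins : ((insert a F : Finset (Cn n)) : Set (Cn n)) ⊆ A := by
    rw [Finset.coe_insert]
    exact Set.insert_subset ha hFA
  have hsep : Separated δ (insert a F) := by
    unfold Separated
    rw [Finset.coe_insert, Set.pairwise_insert]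
    exact ⟨hFs, fun b hb _ => ⟨hcon b hb, nd_comm a b ▸ hcon b hb⟩⟩
  have hle := Nat.le_findGreatest (P := P) (hM _ hins hsep) ⟨_, hins, hsep, rfl⟩
  rw [Finset.card_insert_of_notMem haF] at hle
  omega

theorem exists_separated_net {E A : Set (Cn n)} (hES : E ⊆ S n) (hAE : A ⊆ E) {δ B : ℝ}
    (hδ : 0 < δ) (hB : ∀ t : Finset (Cn n), (t : Set (Cn n)) ⊆ A → Separated δ t → (t.card : ℝ) ≤ B) :
    ∃ F : Finset (Cn n), (F : Set (Cn n)) ⊆ A ∧ Separated δ F ∧ (F.card : ℝ) ≤ B ∧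
      ∀ a ∈ A, ∃ f ∈ F, nd a f < δ := by
  obtain ⟨F, hFA, hFs, hF⟩ := exists_maximal_separated (hAE.trans hES) hδ (M := ⌊B⌋₊)
    fun t ht hs => Nat.le_floor (hB t ht hs)
  exact ⟨F, hFA, hFs, hB F hFA hFs, hF⟩

theorem InUpsilon.card_le {E : Set (Cn n)} {γ : ℝ} (h : InUpsilon E γ) : ∃ C : ℝ, 0 < C ∧
    ∀ x ∈ E, ∀ δ R : ℝ, 0 < δ → δ ≤ R → R ≤ 1 → ∀ t : Finset (Cn n),
      (t : Set (Cn n)) ⊆ nball E x R → Separated δ t → (t.card : ℝ) ≤ C * (R / δ) ^ γ := by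
  obtain ⟨C, hC, h⟩ := h
  refine ⟨C, hC, fun x hx δ R hδ hR hR1 t ht hs => ?_⟩
  have e : R / δ * δ = R := div_mul_cancel₀ _ hδ.ne'
  have h1 := h x hx δ (R / δ) hδ (by rwa [e]) (by rwa [e])
  have h2 := (card_le_packing (k := R / δ) (by rwa [e]) hs).trans h1
  rw [← ENNReal.ofReal_natCast, ENNReal.ofReal_le_ofReal_iff] at h2
  · exact h2
  · have : 0 < R := hδ.trans_le hR
    positivity

theorem PackingBound.inUpsilon {E : Set (Cn n)} {γ C : ℝ} (hC : 0 < C) (h : PackingBound E γ C) :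
    InUpsilon E γ := by
  refine ⟨C, hC, fun x hx R k hR hk _ => ?_⟩
  have e : k * R / R = k := mul_div_cancel_right₀ _ hR.ne'
  have hk0 : 0 < k := by
    rw [← e]
    exact div_pos (hR.trans_le hk) hR
  refine packing_le_ofReal (by positivity) fun t ht hs => ?_
  have := h x hx R (k * R) hR hk t ht hs
  rwa [e] at this

theorem upperDim_lt_of_inUpsilon {E : Set (Cn n)} {γ : ℝ} (hγ : γ < n) (h : InUpsilon E γ) :
    upperDim E < ((n : ℝ) : EReal) :=
  (iInf₂_le γ h).trans_lt (by exact_mod_cast hγ)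

/-- Compactness removes the restriction R ≤ 1: finitely many unit balls cover E, and each obeys the
local bound. -/
theorem exists_packingBound_of_upperDim_lt (hn : 1 ≤ n) {E : Set (Cn n)} (hES : E ⊆ S n)
    (hE : IsClosed E) (h : upperDim E < ((n : ℝ) : EReal)) :
    ∃ γ C : ℝ, 0 ≤ γ ∧ γ < n ∧ 0 < C ∧ PackingBound E γ C := by
  classical
  obtain ⟨γ₀, hγ₀⟩ := iInf_lt_iff.mp h
  obtain ⟨hU, hlt⟩ := iInf_lt_iff.mp hγ₀
  obtain ⟨C, hC, hbd⟩ := hU.card_le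
  have hγn : γ₀ < n := by exact_mod_cast hlt
  have hcpt : IsCompact E := (isCompact_sphere (0 : Cn n) 1).of_isClosed_subset hE hES
  obtain ⟨F, hFE, hF⟩ := hcpt.elim_nhds_subcover (fun e => {z | nd z e < 1}) fun e he =>
    (isOpen_lt (continuous_nd_left e) continuous_const).mem_nhds
      (by simp [nd_self (hES he)])
  -- A nonnegative exponent makes (R/δ)^γ monotone in R/δ.
  set γ := max γ₀ 0
  have hloc : ∀ x ∈ E, ∀ δ R : ℝ, 0 < δ → δ ≤ R → R ≤ 1 → ∀ t : Finset (Cn n),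
      (t : Set (Cn n)) ⊆ nball E x R → Separated δ t → (t.card : ℝ) ≤ C * (R / δ) ^ γ := by
    intro x hx δ R hδ hR hR1 t ht hs
    refine (hbd x hx δ R hδ hR hR1 t ht hs).trans ?_
    gcongr
    · rwa [one_le_div hδ]
    · exact le_max_left _ _
  have hglob : ∀ δ : ℝ, 0 < δ → δ ≤ 1 → ∀ t : Finset (Cn n), (t : Set (Cn n)) ⊆ E →
      Separated δ t → (t.card : ℝ) ≤ F.card * (C * (1 / δ) ^ γ) := by
    intro δ hδ hδ1 t ht hs
    have hsub : t ⊆ F.biUnion fun e => t.filter fun z => nd z e < 1 := by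
      intro z hz
      obtain ⟨e, he, hze⟩ := Set.mem_iUnion₂.mp (hF (ht hz))
      exact Finset.mem_biUnion.mpr ⟨e, he, Finset.mem_filter.mpr ⟨hz, hze⟩⟩
    calc (t.card : ℝ) ≤ ((F.biUnion fun e => t.filter fun z => nd z e < 1).card : ℝ) := by
          exact_mod_cast Finset.card_le_card hsub
      _ ≤ ∑ e ∈ F, ((t.filter fun z => nd z e < 1).card : ℝ) := by
          exact_mod_cast Finset.card_biUnion_le
      _ ≤ ∑ e ∈ F, C * (1 / δ) ^ γ := by
          refine Finset.sum_le_sum fun e he => ?_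
          refine hloc e (hFE e he) δ 1 hδ hδ1 le_rfl _ (fun z hz => ?_)
            (hs.mono (Finset.filter_subset _ _))
          have hz' := Finset.mem_filter.mp (Finset.mem_coe.mp hz)
          exact ⟨ht hz'.1, hz'.2⟩
      _ = _ := by rw [Finset.sum_const, nsmul_eq_mul]
  refine ⟨γ, (F.card + 1) * C, le_max_right _ _, max_lt hγn (by exact_mod_cast hn), by positivity,
    fun x hx δ R hδ hR t ht hs => ?_⟩
  have hR0 : 0 < R := hδ.trans_le hR
  have h1 : (1 : ℝ) ≤ R / δ := by rwa [one_le_div hδ]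
  have hpow : 0 < C * (R / δ) ^ γ := by positivity
  rcases le_or_gt R 1 with hR1 | hR1
  · refine (hloc x hx δ R hδ hR hR1 t ht hs).trans ?_
    rw [mul_assoc]
    exact le_mul_of_one_le_left hpow.le (by linarith [(Nat.cast_nonneg F.card : (0:ℝ) ≤ F.card)])
  · have h2 : (t.card : ℝ) ≤ F.card * (C * (1 / min δ 1) ^ γ) :=
      hglob _ (lt_min hδ one_pos) (min_le_right _ _) t (fun z hz => (ht hz).1)
        (hs.anti (min_le_left _ _))
    have h3 : 1 / min δ 1 ≤ R / δ := by
      rcases le_total δ 1 with h | h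
      · rw [min_eq_left h]; gcongr
      · rw [min_eq_right h]; simpa using h1
    calc (t.card : ℝ) ≤ F.card * (C * (1 / min δ 1) ^ γ) := h2
      _ ≤ F.card * (C * (R / δ) ^ γ) := by
          have : 0 < min δ 1 := lt_min hδ one_pos
          gcongr
      _ ≤ (F.card + 1) * C * (R / δ) ^ γ := by linarith

-- Packing bounds against measures of neighbourhoods.

theorem Separated.disjoint_nball {X : Set (Cn n)} (hX : X ⊆ clB n) {t : Finset (Cn n)} {δ ρ : ℝ}
    (ht : (t : Set (Cn n)) ⊆ S n) (hs : Separated δ t) (hρ : 6 * ρ ≤ δ) :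
    (t : Set (Cn n)).PairwiseDisjoint fun y => nball X y ρ := by
  intro y hy w hw hyw
  refine Set.disjoint_left.mpr fun z hz hz' => ?_
  have h1 := hs hy hw hyw
  have h2 := nd_triangle (S_subset_clB (ht hy)) (hX hz.1) (S_subset_clB (ht hw))
  rw [nd_comm y z] at h2
  linarith [hz.2, hz'.2]

/-- Volume counting. The sets `H y` may be off-centre pieces of the disjoint balls, as needed for
holes. -/
theorem Separated.card_mul_le_measure {X : Set (Cn n)} (hX : X ⊆ clB n) {μ : Measure (Cn n)}
    {A : Set (Cn n)} {t : Finset (Cn n)} {δ ρ b : ℝ}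
    (ht : (t : Set (Cn n)) ⊆ S n) (hs : Separated δ t) (hρ : 6 * ρ ≤ δ)
    {H : Cn n → Set (Cn n)} (hH : ∀ y, MeasurableSet (H y)) (hHb : ∀ y ∈ t, H y ⊆ nball X y ρ)
    (hb : ∀ y ∈ t, ENNReal.ofReal b ≤ μ (H y)) (hA : ∀ y ∈ t, H y ⊆ A) :
    t.card * ENNReal.ofReal b ≤ μ A := by
  have hd : (t : Set (Cn n)).PairwiseDisjoint H := fun y hy w hw hyw =>
    (hs.disjoint_nball hX ht hρ hy hw hyw).mono (hHb y hy) (hHb w hw)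
  calc (t.card : ℝ≥0∞) * ENNReal.ofReal b = ∑ y ∈ t, ENNReal.ofReal b := by
        rw [Finset.sum_const, nsmul_eq_mul]
    _ ≤ ∑ y ∈ t, μ (H y) := Finset.sum_le_sum hb
    _ = μ (⋃ y ∈ t, H y) := (measure_biUnion_finset hd fun y _ => hH y).symm
    _ ≤ μ A := measure_mono (Set.iUnion₂_subset hA)

/-- An ε-net of the relevant part of E has O((R/ε)^γ) points, and the balls of radius 6ε around it
cover the neighbourhood. Leaving X and μ general serves σ and V at once. -/
theorem measure_nbhd_le_of_packingBound {E X : Set (Cn n)} (hES : E ⊆ S n) (hX : X ⊆ clB n)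
    {μ : Measure (Cn n)} {m γ C : ℝ} (hμ : Regular X μ m) (hC : 0 < C)
    (h : PackingBound E γ C) :
    ∃ C' : ℝ, 0 < C' ∧ ∀ x ∈ S n, ∀ R ε : ℝ, 0 < ε → ε < R →
      μ (nball X x R ∩ nbhd X E ε) ≤ ENNReal.ofReal (C' * R ^ γ * ε ^ (m - γ)) := by
  obtain ⟨-, D, -, hD, -, hup⟩ := hμ
  refine ⟨C * 36 ^ γ * (D * 6 ^ m), by positivity, fun x hx R ε hε hεR => ?_⟩
  have hR : 0 < R := hε.trans hεR
  have key : ∀ z ∈ nball X x R, ∀ y ∈ E, nd z y < ε → nd y x < 6 * R := by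
    intro z hz y hy hzy
    have := nd_triangle (S_subset_clB (hES hy)) (hX hz.1) (S_subset_clB hx)
    rw [nd_comm y z] at this
    linarith [hz.2]
  rcases (nball X x R ∩ nbhd X E ε).eq_empty_or_nonempty with h0 | ⟨z₀, hz₀, hz₀'⟩
  · simp [h0]
  -- The packing bound needs a centre in E, so x is replaced by e; two points within 6R of x are
  -- within 36R of each other.
  obtain ⟨e, he, hze⟩ := ndSet_lt_ofReal_iff.mp hz₀'.2
  have hex := key z₀ hz₀ e he hze
  obtain ⟨F, hFA, -, hFc, hF⟩ := exists_separated_net hES (fun z hz => hz.1)  hε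
    (h e he ε (36 * R) hε (by linarith))
  have hsub : nball X x R ∩ nbhd X E ε ⊆ ⋃ f ∈ F, nball X f (6 * ε) := by
    rintro z ⟨hz, hz'⟩
    obtain ⟨y, hy, hzy⟩ := ndSet_lt_ofReal_iff.mp hz'.2
    have hyx := key z hz y hy hzy
    have hye : nd y e < 36 * R := by
      have := nd_triangle (S_subset_clB (hES hy)) (S_subset_clB hx) (S_subset_clB (hES he))
      rw [nd_comm x e] at this
      linarith
    obtain ⟨f, hf, hyf⟩ := hF y ⟨hy, hye⟩
    have := nd_triangle (hX hz.1) (S_subset_clB (hES hy)) (S_subset_clB (hES (hFA hf).1))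
    exact Set.mem_iUnion₂.mpr ⟨f, hf, hz.1, by linarith⟩
  calc μ (nball X x R ∩ nbhd X E ε) ≤ μ (⋃ f ∈ F, nball X f (6 * ε)) := measure_mono hsub
    _ ≤ ∑ f ∈ F, μ (nball X f (6 * ε)) := measure_biUnion_finset_le _ _
    _ ≤ ∑ f ∈ F, ENNReal.ofReal (D * (6 * ε) ^ m) :=
        Finset.sum_le_sum fun f hf => hup f (hES (hFA hf).1) _ (by positivity)
    _ = ENNReal.ofReal (F.card * (D * (6 * ε) ^ m)) := by
        rw [Finset.sum_const, nsmul_eq_mul, ENNReal.ofReal_mul (p := (F.card : ℝ)) (by positivity),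
          ENNReal.ofReal_natCast]
    _ ≤ _ := by
        apply ENNReal.ofReal_le_ofReal
        calc F.card * (D * (6 * ε) ^ m) ≤ (C * (36 * R / ε) ^ γ) * (D * (6 * ε) ^ m) := by gcongr
          _ = _ := by
            rw [Real.div_rpow (by positivity) hε.le, Real.mul_rpow (by norm_num) hR.le,
              Real.mul_rpow (by norm_num) hε.le, Real.rpow_sub hε]
            field_simp

/-- The balls of radius δ/6 around δ-separated points of E are disjoint and lie in E_δ; comparing
masses cancels the power δ^m. -/
theorem inUpsilon_of_measure_nbhd_le {E X : Set (Cn n)} (hES : E ⊆ S n) (hX : X ⊆ clB n)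
    (hXm : MeasurableSet X) {μ : Measure (Cn n)} {m s C : ℝ} (hμ : Regular X μ m) (hC : 0 < C)
    (h : ∀ x ∈ E, ∀ R ε : ℝ, 0 < ε → ε < R →
      μ (nball X x R ∩ nbhd X E ε) ≤ ENNReal.ofReal (C * R ^ s * ε ^ (m - s))) :
    InUpsilon E s := by
  obtain ⟨c, -, hc, -, hlow, -⟩ := hμ
  refine ⟨C * 6 ^ s * 6 ^ m / c, by positivity, fun x hx δ k hδ hk hk1 => ?_⟩
  have hk0 : 0 < k := pos_of_mul_pos_left (hδ.trans_le hk) hδ.le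
  refine packing_le_ofReal (by positivity) fun t ht hs => ?_
  have h1 := (hs.card_mul_le_measure (ρ := δ / 6) hX (fun z hz => hES (ht hz).1) (by linarith)
    (fun y => measurableSet_nball hXm y (δ / 6)) (fun y _ => subset_rfl)
    (fun y hy => hlow y (hES (ht hy).1) _ (by positivity) (by linarith))
    (A := nball X x (6 * (k * δ)) ∩ nbhd X E δ) fun y hy z hz => by
      refine ⟨⟨hz.1, ?_⟩, hz.1, ndSet_lt_ofReal_iff.mpr ⟨y, (ht hy).1, by linarith [hz.2]⟩⟩
      have h2 := nd_triangle (hX hz.1) (S_subset_clB (hES (ht hy).1)) (S_subset_clB (hES hx))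
      linarith [hz.2, (ht hy).2]).trans
    (h x hx (6 * (k * δ)) δ hδ (by linarith))
  rw [← ENNReal.ofReal_natCast, ← ENNReal.ofReal_mul (by positivity),
    ENNReal.ofReal_le_ofReal_iff (by positivity)] at h1
  rw [Real.div_rpow hδ.le (by norm_num), Real.mul_rpow (by norm_num) (by positivity),
    Real.mul_rpow hk0.le hδ.le, Real.rpow_sub hδ] at h1
  rw [div_mul_eq_mul_div, le_div_iff₀ hc]
  have hp : 0 < δ ^ m := by positivity
  have e1 : t.card * (c * (δ ^ m / 6 ^ m)) = (t.card * c) * (δ ^ m / 6 ^ m) := by ring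
  have e2 : C * (6 ^ s * (k ^ s * δ ^ s)) * (δ ^ m / δ ^ s) =
      (C * 6 ^ s * 6 ^ m * k ^ s) * (δ ^ m / 6 ^ m) := by field_simp
  rw [e1, e2] at h1
  exact le_of_mul_le_mul_right h1 (by positivity)

-- Integrals of negative powers of the distance to E.

/-- Dyadic decomposition by the size of d(z,E). The layers start at R/2 because the neighbourhood
bounds require ε < R. Where d(z,E) = 0 every indicator is 1 and the series diverges. -/
theorem ndSet_rpow_neg_le_tsum (E : Set (Cn n)) {R a : ℝ} (hR : 0 < R) (ha : 0 ≤ a) (z : Cn n) :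
    ndSet z E ^ (-a) ≤ ENNReal.ofReal ((R / 2) ^ (-a)) +
      ∑' j : ℕ, {z | ndSet z E < ENNReal.ofReal (R / 2 ^ (j + 1))}.indicator
        (fun _ => ENNReal.ofReal ((R / 2 ^ (j + 2)) ^ (-a))) z := by
  have hanti : ∀ r : ℝ, 0 < r → ENNReal.ofReal r ≤ ndSet z E →
      ndSet z E ^ (-a) ≤ ENNReal.ofReal (r ^ (-a)) := by
    intro r hr h
    rw [← ENNReal.ofReal_rpow_of_pos hr]
    rw [ENNReal.rpow_neg, ENNReal.rpow_neg, ENNReal.inv_le_inv]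
    exact ENNReal.rpow_le_rpow h ha
  rcases le_or_gt (ENNReal.ofReal (R / 2)) (ndSet z E) with h | h
  · exact (hanti _ (by positivity) h).trans le_self_add
  refine le_add_of_nonneg_of_le zero_le ?_
  rcases eq_or_ne (ndSet z E) 0 with h0 | h0
  · have htop : (∑' j : ℕ, {z | ndSet z E < ENNReal.ofReal (R / 2 ^ (j + 1))}.indicator
        (fun _ => ENNReal.ofReal ((R / 2 ^ (j + 2)) ^ (-a))) z) = ∞ := by
      rw [eq_top_iff]
      calc (∞ : ℝ≥0∞) = ∑' _ : ℕ, ENNReal.ofReal (R ^ (-a)) :=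
            (ENNReal.tsum_const_eq_top_of_ne_zero
              (by rw [Ne, ENNReal.ofReal_eq_zero, not_le]; positivity)).symm
        _ ≤ _ := by
          refine ENNReal.tsum_le_tsum fun j => ?_
          rw [Set.indicator_of_mem]
          · refine ENNReal.ofReal_le_ofReal ?_
            rw [Real.rpow_neg hR.le, Real.rpow_neg (by positivity)]
            gcongr
            exact div_le_self hR.le (one_le_pow₀ (by norm_num))
          · show ndSet z E < _
            rw [h0]
            simp
            positivity
    rw [htop]
    exact le_top
  · have hfin : ndSet z E ≠ ∞ := (h.trans ENNReal.ofReal_lt_top).ne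
    set d := (ndSet z E).toReal with hd
    have hd0 : 0 < d := ENNReal.toReal_pos h0 hfin
    have hdE : ndSet z E = ENNReal.ofReal d := (ENNReal.ofReal_toReal hfin).symm
    rw [hdE, ENNReal.ofReal_lt_ofReal_iff (by positivity)] at h
    obtain ⟨j, hj1, hj2⟩ : ∃ j : ℕ, R / 2 ^ (j + 2) ≤ d ∧ d < R / 2 ^ (j + 1) := by
      have hex : ∃ j : ℕ, R / 2 ^ (j + 2) ≤ d := by
        obtain ⟨j, hj⟩ := pow_unbounded_of_one_lt (R / d) (one_lt_two : (1 : ℝ) < 2)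
        refine ⟨j, ?_⟩
        rw [div_lt_iff₀ hd0] at hj
        rw [div_le_iff₀ (by positivity), pow_add]
        have : 0 < d * 2 ^ j := by positivity
        linarith
      classical
      refine ⟨Nat.find hex, Nat.find_spec hex, ?_⟩
      rcases Nat.eq_zero_or_pos (Nat.find hex) with h0 | h0
      · rw [h0]; simpa using h
      · have := Nat.find_min hex (Nat.sub_one_lt h0.ne')
        rw [show Nat.find hex - 1 + 2 = Nat.find hex + 1 by omega] at this
        exact not_le.mp this
    refine le_trans ?_ (ENNReal.le_tsum j)
    rw [Set.indicator_of_mem]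
    · refine hanti _ (by positivity) ?_
      rw [hdE]
      exact ENNReal.ofReal_le_ofReal hj1
    · show ndSet z E < _
      rw [hdE, ENNReal.ofReal_lt_ofReal_iff (by positivity)]
      exact hj2

theorem lintegral_ndSet_rpow_le {E X : Set (Cn n)} {μ : Measure (Cn n)}
    {m s a C : ℝ} (hμ : Regular X μ m) (hC : 0 < C)
    (h : ∀ x ∈ S n, ∀ R ε : ℝ, 0 < ε → ε < R →
      μ (nball X x R ∩ nbhd X E ε) ≤ ENNReal.ofReal (C * R ^ s * ε ^ (m - s)))
    (ha : 0 ≤ a) (has : a < m - s) :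
    ∃ C' : ℝ, 0 < C' ∧ ∀ x ∈ S n, ∀ R : ℝ, 0 < R →
      ∫⁻ z in nball X x R, ndSet z E ^ (-a) ∂μ ≤ ENNReal.ofReal (C' * R ^ (m - a)) := by
  obtain ⟨-, D, -, hD, -, hup⟩ := hμ
  -- The j-th layer contributes a multiple of q^j, and q < 1 is exactly a < m - s.
  set q : ℝ := 2 ^ (-(m - s - a)) with hq
  have hq0 : 0 < q := by positivity
  have hq1 : q < 1 := Real.rpow_lt_one_of_one_lt_of_neg one_lt_two (by linarith)
  have hq1' : 0 < 1 - q := by linarith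
  refine ⟨2 ^ a * D + C * 2 ^ a * q * (1 - q)⁻¹, by positivity, fun x hx R hR => ?_⟩
  have hmeas : ∀ j : ℕ, MeasurableSet {z | ndSet z E < ENNReal.ofReal (R / 2 ^ (j + 1))} :=
    fun j => measurable_ndSet E measurableSet_Iio
  have hterm : ∀ j : ℕ, ∫⁻ z in nball X x R,
      {z | ndSet z E < ENNReal.ofReal (R / 2 ^ (j + 1))}.indicator
        (fun _ => ENNReal.ofReal ((R / 2 ^ (j + 2)) ^ (-a))) z ∂μ ≤
      ENNReal.ofReal (C * 2 ^ a * q * R ^ (m - a) * q ^ j) := by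
    intro j
    rw [lintegral_indicator_const (hmeas j), Measure.restrict_apply (hmeas j)]
    have hset : {z | ndSet z E < ENNReal.ofReal (R / 2 ^ (j + 1))} ∩ nball X x R =
        nball X x R ∩ nbhd X E (R / 2 ^ (j + 1)) := by
      ext z
      exact ⟨fun hz => ⟨hz.2, hz.2.1, hz.1⟩, fun hz => ⟨hz.2.2, hz.1⟩⟩
    rw [hset]
    have hlt : R / 2 ^ (j + 1) < R := div_lt_self hR (one_lt_pow₀ one_lt_two (by omega))
    refine (mul_le_mul_right (h x hx R _ (by positivity) hlt) _).trans ?_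
    rw [← ENNReal.ofReal_mul (by positivity)]
    apply ENNReal.ofReal_le_ofReal
    apply le_of_eq
    have e1 : (R / 2 ^ (j + 2)) ^ (-a) = R ^ (-a) * (2 ^ a * 2 ^ ((j + 1 : ℝ) * a)) := by
      rw [Real.div_rpow hR.le (by positivity), ← Real.rpow_natCast 2, ← Real.rpow_mul (by norm_num),
        ← Real.rpow_add two_pos, div_eq_mul_inv, ← Real.rpow_neg (by norm_num)]
      push_cast
      ring_nf
    have e2 : (R / 2 ^ (j + 1)) ^ (m - s) = R ^ (m - s) * 2 ^ (-((j + 1 : ℝ) * (m - s))) := by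
      rw [Real.div_rpow hR.le (by positivity), ← Real.rpow_natCast 2, ← Real.rpow_mul (by norm_num),
        div_eq_mul_inv, ← Real.rpow_neg (by norm_num)]
      push_cast
      ring_nf
    have e3 : q * q ^ j = 2 ^ ((j + 1 : ℝ) * a) * 2 ^ (-((j + 1 : ℝ) * (m - s))) := by
      rw [← pow_succ', hq, ← Real.rpow_natCast, ← Real.rpow_mul (by norm_num),
        ← Real.rpow_add two_pos]
      push_cast
      ring_nf
    have e4 : R ^ (m - a) = R ^ (-a) * R ^ s * R ^ (m - s) := by
      rw [← Real.rpow_add hR, ← Real.rpow_add hR]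
      ring_nf
    calc _ = C * 2 ^ a * (R ^ (-a) * R ^ s * R ^ (m - s)) *
          (2 ^ ((j + 1 : ℝ) * a) * 2 ^ (-((j + 1 : ℝ) * (m - s)))) := by rw [e1, e2]; ring
      _ = _ := by rw [← e3, ← e4]; ring
  calc ∫⁻ z in nball X x R, ndSet z E ^ (-a) ∂μ
      ≤ ∫⁻ z in nball X x R, (ENNReal.ofReal ((R / 2) ^ (-a)) +
      ∑' j : ℕ, {z | ndSet z E < ENNReal.ofReal (R / 2 ^ (j + 1))}.indicator
        (fun _ => ENNReal.ofReal ((R / 2 ^ (j + 2)) ^ (-a))) z) ∂μ :=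
        lintegral_mono fun z => ndSet_rpow_neg_le_tsum E hR ha z
    _ = ENNReal.ofReal ((R / 2) ^ (-a)) * μ (nball X x R) +
        ∑' j : ℕ, ∫⁻ z in nball X x R,
          {z | ndSet z E < ENNReal.ofReal (R / 2 ^ (j + 1))}.indicator
          (fun _ => ENNReal.ofReal ((R / 2 ^ (j + 2)) ^ (-a))) z ∂μ := by
        rw [lintegral_add_left measurable_const, lintegral_const, Measure.restrict_apply_univ,
          lintegral_tsum fun j => (measurable_const.indicator (hmeas j)).aemeasurable]
    _ ≤ ENNReal.ofReal ((R / 2) ^ (-a)) * ENNReal.ofReal (D * R ^ m) +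
        ∑' j : ℕ, ENNReal.ofReal (C * 2 ^ a * q * R ^ (m - a) * q ^ j) := by
        gcongr with j
        · exact hup x hx R hR
        · exact hterm j
    _ = _ := by
        have hsum : Summable fun j : ℕ => C * 2 ^ a * q * R ^ (m - a) * q ^ j :=
          (summable_geometric_of_lt_one hq0.le hq1).mul_left _
        rw [← ENNReal.ofReal_tsum_of_nonneg (fun j => by positivity) hsum, tsum_mul_left,
          tsum_geometric_of_lt_one hq0.le hq1, ← ENNReal.ofReal_mul (by positivity),
          ← ENNReal.ofReal_add (by positivity) (by positivity),
          Real.div_rpow hR.le (by norm_num), Real.rpow_neg two_pos.le, Real.rpow_sub hR,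
          Real.rpow_neg hR.le]
        congr 1
        field_simp

-- The packing integral.

theorem PackingIntegralBound.exists_inUpsilon {E : Set (Cn n)} (h : PackingIntegralBound E) :
    ∃ γ : ℝ, γ < n ∧ InUpsilon E γ := by
  obtain ⟨a, C, ha, han, hC, h⟩ := h
  have hb : 0 < (n : ℝ) - a := by linarith
  refine ⟨n - a, by linarith, PackingBound.inUpsilon (C := C * 2 ^ ((n : ℝ) - a) * 2) (by positivity)
    fun x hx δ R hδ hR t ht hs => ?_⟩
  have hR0 : 0 < R := hδ.trans_le hR
  have h1 : (t.card : ℝ≥0∞) * ENNReal.ofReal ((δ / 2) ^ ((n : ℝ) - a) / δ) *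
      volume (Set.Ioo (δ / 2) δ) ≤ ENNReal.ofReal (C * R ^ ((n : ℝ) - a)) := by
    rw [← setLIntegral_const]
    refine le_trans ?_ (h x hx R hR0)
    refine le_trans ?_ (lintegral_mono_set
      -- On (δ/2, δ) a δ-separated set is also η-separated, so this part of the integral alone
      -- bounds its cardinality.
      (fun η hη => ⟨by linarith [hη.1], hη.2.trans_le hR⟩ : Set.Ioo (δ / 2) δ ⊆ Set.Ioo 0 R))
    refine setLIntegral_mono' measurableSet_Ioo fun η hη => ?_
    have hη0 : 0 < η := by linarith [hη.1]
    refine mul_le_mul' (card_le_packing ?_ (hs.anti hη.2.le)) (ENNReal.ofReal_le_ofReal ?_)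
    · rwa [div_mul_cancel₀ _ hη0.ne']
    · have := hη.1.le
      have := hη.2.le
      gcongr
  rw [Real.volume_Ioo, ← ENNReal.ofReal_natCast, ← ENNReal.ofReal_mul (by positivity),
    ← ENNReal.ofReal_mul (by positivity), ENNReal.ofReal_le_ofReal_iff (by positivity)] at h1
  rw [Real.div_rpow hδ.le two_pos.le] at h1
  rw [Real.div_rpow hR0.le hδ.le, mul_div_assoc', le_div_iff₀ (by positivity)]
  have e : t.card * (δ ^ ((n : ℝ) - a) / 2 ^ ((n : ℝ) - a) / δ) * (δ - δ / 2) =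
      t.card * δ ^ ((n : ℝ) - a) / (2 ^ ((n : ℝ) - a) * 2) := by
    field_simp
    ring
  rw [e, div_le_iff₀ (by positivity)] at h1
  linarith

theorem packingIntegralBound_of_packingBound (hn : 1 ≤ n) {E : Set (Cn n)} {γ C : ℝ} (hγ0 : 0 ≤ γ)
    (hγ : γ < n) (hC : 0 < C) (h : PackingBound E γ C) : PackingIntegralBound E := by
  have hn' : (1 : ℝ) ≤ n := by exact_mod_cast hn
  -- With this a the integrand is at most a multiple of δ^(a-1), integrable at 0.
  set a : ℝ := (n - γ) / 2 with ha
  have ha0 : 0 < a := by rw [ha]; linarith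
  have e : (n : ℝ) - a = γ + a := by rw [ha]; ring
  refine ⟨a, C / a, ha0, by rw [ha]; linarith, by positivity, fun x hx R hR => ?_⟩
  calc ∫⁻ δ in Set.Ioo 0 R, (packing E x δ (R / δ) : ℝ≥0∞) * ENNReal.ofReal (δ ^ ((n : ℝ) - a) / δ)
      ≤ ∫⁻ δ in Set.Ioo 0 R, ENNReal.ofReal (C * R ^ γ * δ ^ (a - 1)) := by
        refine setLIntegral_mono' measurableSet_Ioo fun δ hδ => ?_
        have hδ0 : 0 < δ := hδ.1
        have hp : (packing E x δ (R / δ) : ℝ≥0∞) ≤ ENNReal.ofReal (C * (R / δ) ^ γ) :=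
          packing_le_ofReal (by positivity) fun t ht hs =>
            h x hx δ R hδ0 hδ.2.le t (by rwa [div_mul_cancel₀ _ hδ0.ne'] at ht) hs
        refine (mul_le_mul_left hp _).trans ?_
        rw [← ENNReal.ofReal_mul (by positivity)]
        apply ENNReal.ofReal_le_ofReal
        apply le_of_eq
        rw [Real.div_rpow hR.le hδ0.le, e, Real.rpow_add hδ0, Real.rpow_sub hδ0, Real.rpow_one]
        field_simp
    _ = ENNReal.ofReal (∫ δ in Set.Ioo 0 R, C * R ^ γ * δ ^ (a - 1)) := by
        rw [ofReal_integral_eq_lintegral_ofReal]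
        · have := (intervalIntegral.intervalIntegrable_rpow' (a := 0) (b := R) (r := a - 1)
            (by linarith)).const_mul (C * R ^ γ)
          rw [intervalIntegrable_iff_integrableOn_Ioo_of_le hR.le] at this
          exact this
        · refine (ae_restrict_iff' measurableSet_Ioo).mpr (Filter.Eventually.of_forall fun δ hδ => ?_)
          have := hδ.1
          show 0 ≤ _
          positivity
    _ = _ := by
        rw [← integral_Ioc_eq_integral_Ioo, ← intervalIntegral.integral_of_le hR.le,
          intervalIntegral.integral_const_mul, integral_rpow (Or.inl (by linarith)), sub_add_cancel,
          Real.zero_rpow ha0.ne', sub_zero, e, Real.rpow_add hR]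
        congr 1
        ring

-- The logarithmic integral.

/-- This is log t ≤ t^a/a at t = R/d. Positive and negative parts are distributed over the two sides
so that no subtraction occurs and d = 0, d = ∞ are included. -/
theorem toENNReal_log_inv_add_le {d : ℝ≥0∞} {R a : ℝ} (hR : 0 < R) (ha : 0 < a) :
    (ENNReal.log d⁻¹).toENNReal + ENNReal.ofReal (-Real.log (1 / R)) ≤
      (-ENNReal.log d⁻¹).toENNReal + (ENNReal.ofReal (Real.log (1 / R)) +
        ENNReal.ofReal (R ^ a / a) * d ^ (-a)) := by
  rcases eq_or_ne d 0 with rfl | h0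
  · have h1 : ENNReal.ofReal (R ^ a / a) ≠ 0 := by
      rw [Ne, ENNReal.ofReal_eq_zero, not_le]; positivity
    simp [ENNReal.zero_rpow_of_neg (neg_lt_zero.mpr ha), ENNReal.mul_top h1]
  rcases eq_or_ne d ∞ with rfl | ht
  · simp
  obtain ⟨D, hD0, rfl⟩ : ∃ D : ℝ, 0 < D ∧ d = ENNReal.ofReal D :=
    ⟨d.toReal, ENNReal.toReal_pos h0 ht, (ENNReal.ofReal_toReal ht).symm⟩
  have hlog : ENNReal.log (ENNReal.ofReal D)⁻¹ = ((-Real.log D : ℝ) : EReal) := by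
    rw [← ENNReal.ofReal_inv_of_pos hD0, ENNReal.log_ofReal_of_pos (by positivity), Real.log_inv]
  have key : -Real.log D ≤ -Real.log R + R ^ a / a * D ^ (-a) := by
    have := Real.log_le_rpow_div (x := R / D) (by positivity) ha
    rw [Real.log_div hR.ne' hD0.ne', Real.div_rpow hR.le hD0.le] at this
    rw [Real.rpow_neg hD0.le]
    calc -Real.log D ≤ -Real.log R + R ^ a / D ^ a / a := by linarith
      _ = _ := by congr 1; field_simp
  rw [hlog, ← EReal.coe_neg, EReal.toENNReal_of_ne_top (EReal.coe_ne_top _),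
    EReal.toENNReal_of_ne_top (EReal.coe_ne_top _), EReal.toReal_coe, EReal.toReal_coe,
    ENNReal.ofReal_rpow_of_pos hD0, one_div, Real.log_inv, neg_neg, neg_neg,
    ← ENNReal.ofReal_mul (by positivity)]
  have hpos : 0 ≤ R ^ a / a * D ^ (-a) := by positivity
  rw [← ENNReal.toReal_le_toReal (by finiteness) (by finiteness),
    ENNReal.toReal_add (by finiteness) (by finiteness),
    ENNReal.toReal_add (by finiteness) (by finiteness),
    ENNReal.toReal_add (by finiteness) (by finiteness), ENNReal.toReal_ofReal hpos]
  simp only [ENNReal.toReal_ofReal']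
  have h1 := max_zero_sub_eq_self (Real.log D)
  have h2 := max_zero_sub_eq_self (Real.log R)
  linarith

theorem logIntegralBound_of_powerIntegralBound (hn : 1 ≤ n) {E : Set (Cn n)}
    (h : PowerIntegralBound E) : LogIntegralBound E := by
  obtain ⟨a, C, ha, hC, h⟩ := h
  obtain ⟨-, D, -, hD, -, hup⟩ := regular_sigma hn
  refine ⟨C / a, by positivity, fun x hx R hR => ?_⟩
  set A := nball (S n) x R with hA
  set μ := sigma n with hμ
  set f : Cn n → EReal := fun z => ENNReal.log (ndSet z E)⁻¹ with hf
  have hAfin : μ A ≠ ∞ := ((hup x hx R hR).trans_lt ENNReal.ofReal_lt_top).ne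
  have hg : ∫⁻ z in A, ENNReal.ofReal (R ^ a / a) * ndSet z E ^ (-a) ∂μ ≤
      ENNReal.ofReal (C / a * R ^ n) := by
    rw [lintegral_const_mul _ ((measurable_ndSet E).pow_const _)]
    refine (mul_le_mul_right (h x hx R hR) _).trans_eq ?_
    rw [← ENNReal.ofReal_mul (by positivity), Real.rpow_sub hR, Real.rpow_natCast]
    congr 1
    field_simp
  set c := Real.log (1 / R) with hc
  have hint : ∫⁻ z in A, (f z).toENNReal ∂μ + ENNReal.ofReal (-c) * μ A ≤
      ∫⁻ z in A, (-f z).toENNReal ∂μ + (ENNReal.ofReal c * μ A + ENNReal.ofReal (C / a * R ^ n)) := by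
    calc _ = ∫⁻ z in A, ((f z).toENNReal + ENNReal.ofReal (-c)) ∂μ := by
          rw [lintegral_add_right _ measurable_const, lintegral_const, Measure.restrict_apply_univ]
      _ ≤ ∫⁻ z in A, ((-f z).toENNReal + (ENNReal.ofReal c +
            ENNReal.ofReal (R ^ a / a) * ndSet z E ^ (-a))) ∂μ :=
          lintegral_mono fun z => toENNReal_log_inv_add_le hR ha
      _ = ∫⁻ z in A, (-f z).toENNReal ∂μ + (ENNReal.ofReal c * μ A +
            ∫⁻ z in A, ENNReal.ofReal (R ^ a / a) * ndSet z E ^ (-a) ∂μ) := by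
          have hm : Measurable fun z : Cn n => ENNReal.ofReal (R ^ a / a) * ndSet z E ^ (-a) :=
            ((measurable_ndSet E).pow_const _).const_mul _
          rw [lintegral_add_right _ (hm.const_add _), lintegral_add_left measurable_const,
            lintegral_const, Measure.restrict_apply_univ]
      _ ≤ _ := by gcongr
  unfold eintegral
  set P := ∫⁻ z in A, (f z).toENNReal ∂μ
  set Q := ∫⁻ z in A, (-f z).toENNReal ∂μ
  -- An infinite negative part, as for E = ∅, makes the difference -∞ by the `EReal` convention.
  rcases eq_or_ne Q ∞ with hQ | hQ
  · rw [hQ]; simp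
  have hPfin : P ≠ ∞ := by
    refine ((le_self_add.trans hint).trans_lt ?_).ne
    finiteness
  lift P to NNReal using hPfin with p
  lift Q to NNReal using hQ with q
  have hG : 0 ≤ C / a * R ^ n := by positivity
  rw [← ENNReal.toReal_le_toReal (by finiteness) (by finiteness),
    ENNReal.toReal_add (by finiteness) (by finiteness),
    ENNReal.toReal_add (by finiteness) (by finiteness),
    ENNReal.toReal_add (by finiteness) (by finiteness), ENNReal.toReal_ofReal hG,
    ENNReal.toReal_mul, ENNReal.toReal_mul, ENNReal.toReal_ofReal', ENNReal.toReal_ofReal',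
    ENNReal.coe_toReal, ENNReal.coe_toReal] at hint
  rw [EReal.coe_nnreal_eq_coe_real, EReal.coe_nnreal_eq_coe_real, ← EReal.coe_sub,
    EReal.coe_le_coe_iff]
  have h1 := max_zero_sub_eq_self c
  have h2 : (max c 0 - max (-c) 0) * (μ A).toReal = c * (μ A).toReal := by rw [h1]
  have h3 : μ.real A = (μ A).toReal := rfl
  rw [h3]
  linarith

theorem uhc_of_logIntegralBound (hn : 1 ≤ n) {E : Set (Cn n)} (h : LogIntegralBound E) : UHC E := by
  obtain ⟨C, hC, h⟩ := h
  obtain ⟨c, D, hc, hD, hlow, hup⟩ := regular_sigma hn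
  -- If d(z,E) ≤ κr on the whole ball, the integrand is at least log(1/r) + C/c + 1 there. As σ(B) ≥
  -- c r^n, the integral exceeds the allowed bound by at least σ(B).
  set κ : ℝ := Real.exp (-(C / c) - 1) with hκ
  have hκ0 : 0 < κ := Real.exp_pos _
  have hCc : 0 < C / c := by positivity
  refine ⟨κ, hκ0, by rw [hκ, Real.exp_lt_one_iff]; linarith, fun x hx r hr hr2 => ?_⟩
  by_contra! hlt
  set A := nball (S n) x r with hA
  set L := Real.log (1 / (κ * r)) with hL
  have hLf : ∀ z ∈ A, (L : EReal) ≤ ENNReal.log (ndSet z E)⁻¹ := by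
    intro z hz
    have h1 : ndSet z E ≤ ENNReal.ofReal (κ * r) :=
      (le_iSup₂ (f := fun y (_ : y ∈ A) => ndSet y E) z hz).trans hlt.le
    rw [hL, one_div, ← ENNReal.log_ofReal_of_pos (by positivity)]
    apply ENNReal.log_monotone
    rw [ENNReal.ofReal_inv_of_pos (by positivity)]
    exact ENNReal.inv_le_inv.mpr h1
  have hm : MeasurableSet A := measurableSet_nball measurableSet_S x r
  have hAfin : sigma n A ≠ ∞ := ((hup x hx r hr).trans_lt ENNReal.ofReal_lt_top).ne
  have h1 : ENNReal.ofReal L * sigma n A ≤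
      ∫⁻ z in A, (ENNReal.log (ndSet z E)⁻¹).toENNReal ∂(sigma n) := by
    rw [← setLIntegral_const]
    refine setLIntegral_mono' hm fun z hz => ?_
    rw [← EReal.real_coe_toENNReal]
    exact EReal.toENNReal_le_toENNReal (hLf z hz)
  have h2 : ∫⁻ z in A, (-ENNReal.log (ndSet z E)⁻¹).toENNReal ∂(sigma n) ≤
      ENNReal.ofReal (-L) * sigma n A := by
    rw [← setLIntegral_const]
    refine setLIntegral_mono' hm fun z hz => ?_
    rw [← EReal.real_coe_toENNReal]
    refine EReal.toENNReal_le_toENNReal ?_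
    rw [EReal.coe_neg]
    exact EReal.neg_le_neg_iff.mpr (hLf z hz)
  have h3 := (EReal.sub_le_sub (EReal.coe_ennreal_le_coe_ennreal_iff.mpr h1)
    (EReal.coe_ennreal_le_coe_ennreal_iff.mpr h2)).trans (h x hx r hr)
  set M := (sigma n).real A with hM
  have hσ : sigma n A = ENNReal.ofReal M := (ENNReal.ofReal_toReal hAfin).symm
  have hM0 : 0 ≤ M := ENNReal.toReal_nonneg
  have hMlow : c * r ^ n ≤ M := by
    have := hlow x hx r hr hr2
    rwa [← hA, hσ, ENNReal.ofReal_le_ofReal_iff hM0, Real.rpow_natCast] at this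
  rw [hσ, ← ENNReal.ofReal_mul' hM0, ← ENNReal.ofReal_mul' hM0, EReal.coe_ennreal_ofReal,
    EReal.coe_ennreal_ofReal, ← EReal.coe_sub, EReal.coe_le_coe_iff, neg_mul,
    max_zero_sub_eq_self] at h3
  have hLe : L = Real.log (1 / r) + (C / c + 1) := by
    rw [hL, one_div, one_div, Real.log_inv, Real.log_inv, Real.log_mul hκ0.ne' hr.ne', hκ,
      Real.log_exp]
    ring
  rw [hLe] at h3
  have hpos : 0 < c * r ^ n := by positivity
  have h4 : C * r ^ n ≤ C / c * M := by
    calc C * r ^ n = C / c * (c * r ^ n) := by field_simp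
      _ ≤ _ := by gcongr
  linarith

-- From holes to dimension less than n.

theorem card_le_of_separated_sphere (hn : 1 ≤ n) : ∃ C : ℝ, 0 < C ∧ ∀ x ∈ S n, ∀ δ R : ℝ, 0 < δ →
    δ ≤ 1 → δ ≤ R → ∀ t : Finset (Cn n), (t : Set (Cn n)) ⊆ nball (S n) x R → Separated δ t →
      (t.card : ℝ) ≤ C * (R / δ) ^ n := by
  obtain ⟨c, D, hc, hD, hlow, hup⟩ := regular_sigma hn
  refine ⟨D * 36 ^ n / c, by positivity, fun x hx δ R hδ hδ1 hR t ht hs => ?_⟩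
  have hR0 : 0 < R := hδ.trans_le hR
  have h1 := (hs.card_mul_le_measure (ρ := δ / 6) S_subset_clB (fun z hz => (ht hz).1) (by linarith)
    (fun y => measurableSet_nball measurableSet_S y (δ / 6)) (fun y _ => subset_rfl)
    (fun y hy => hlow y (ht hy).1 _ (by positivity) (by linarith))
    (A := nball (S n) x (6 * R)) fun y hy z hz => by
      refine ⟨hz.1, ?_⟩
      have h2 := nd_triangle (S_subset_clB hz.1) (S_subset_clB (ht hy).1) (S_subset_clB hx)
      linarith [hz.2, (ht hy).2]).trans (hup x hx (6 * R) (by positivity))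
  rw [← ENNReal.ofReal_natCast, ← ENNReal.ofReal_mul (by positivity),
    ENNReal.ofReal_le_ofReal_iff (by positivity), Real.rpow_natCast, Real.rpow_natCast] at h1
  rw [div_mul_eq_mul_div, le_div_iff₀ hc, div_pow, mul_div_assoc', le_div_iff₀ (by positivity)]
  rw [div_pow, mul_div_assoc', mul_div_assoc', div_le_iff₀ (by positivity)] at h1
  calc t.card * c * δ ^ n = t.card * (c * δ ^ n) := by ring
    _ ≤ _ := h1
    _ = _ := by rw [mul_pow, show (36 : ℝ) = 6 * 6 by norm_num, mul_pow]; ring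

/-- The part of the sphere at distance comparable to `r` from `E`. -/
def shell (E : Set (Cn n)) (c r : ℝ) : Set (Cn n) :=
  {z ∈ S n | ENNReal.ofReal (c * r) ≤ ndSet z E ∧ ndSet z E < ENNReal.ofReal (6 * r)}

theorem measurableSet_shell (E : Set (Cn n)) (c r : ℝ) : MeasurableSet (shell E c r) :=
  measurableSet_S.inter ((measurable_ndSet E measurableSet_Ici).inter
    (measurable_ndSet E measurableSet_Iio))

theorem UHC.exists_hole {E : Set (Cn n)} (hES : E ⊆ S n) (h : UHC E) :
    ∃ c : ℝ, 0 < c ∧ c < 1 ∧ ∀ w ∈ E, ∀ r : ℝ, 0 < r → r ≤ 2 →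
      ∃ y ∈ S n, nball (S n) y (c * r) ⊆ shell E c r ∩ nball (S n) w (6 * r) := by
  obtain ⟨C, hC, hC1, h⟩ := h
  -- The supremum need not be attained, so the hole is centred at y with d(y,E) ≥ Cr/2. The
  -- quasi-triangle inequality leaves Cr/6 - Cr/12 = Cr/12 for points within Cr/12 of y.
  refine ⟨C / 12, by positivity, by linarith, fun w hw r hr hr2 => ?_⟩
  have hlt : ENNReal.ofReal (C * r / 2) < ⨆ y ∈ nball (S n) w r, ndSet y E := by
    refine lt_of_lt_of_le ?_ (h w (hES hw) r hr hr2)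
    rw [ENNReal.ofReal_lt_ofReal_iff (by positivity)]
    have : 0 < C * r := by positivity
    linarith
  obtain ⟨y, hy⟩ := lt_iSup_iff.mp hlt
  obtain ⟨hyw, hy⟩ := lt_iSup_iff.mp hy
  have hye := ofReal_le_ndSet_iff.mp hy.le
  refine ⟨y, hyw.1, fun z hz => ?_⟩
  have hzw : nd z w < 6 * r := by
    have := nd_triangle (S_subset_clB hz.1) (S_subset_clB hyw.1) (S_subset_clB (hES hw))
    have h1 := hz.2
    have h2 := hyw.2
    nlinarith
  refine ⟨⟨hz.1, ofReal_le_ndSet_iff.mpr fun e he => ?_,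
    ndSet_lt_ofReal_iff.mpr ⟨w, hw, hzw⟩⟩, hz.1, hzw⟩
  have h1 := hye e he
  have h2 := nd_triangle (S_subset_clB hyw.1) (S_subset_clB hz.1) (S_subset_clB (hES he))
  rw [nd_comm y z] at h2
  linarith [hz.2]

/-- Thin t to a maximal 36r-separated set F. Each point of F owns a hole of mass of order r^n and
accounts for O((r/δ)^n) points of t, so the holes have total mass at least a multiple of |t|δ^n,
whatever r is. Holes lie within 6r of their owners, hence 36r makes them disjoint. -/
theorem card_mul_pow_le_sigma_shell (hn : 1 ≤ n) {E : Set (Cn n)} (hES : E ⊆ S n) {c : ℝ}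
    (hc : 0 < c) (hc1 : c < 1)
    (hole : ∀ w ∈ E, ∀ r : ℝ, 0 < r → r ≤ 2 →
      ∃ y ∈ S n, nball (S n) y (c * r) ⊆ shell E c r ∩ nball (S n) w (6 * r)) :
    ∃ b : ℝ, 0 < b ∧ ∀ x ∈ E, ∀ δ r R : ℝ, 0 < δ → δ ≤ r → r ≤ R → R ≤ 1 →
      ∀ t : Finset (Cn n), (t : Set (Cn n)) ⊆ nball E x R → Separated δ t →
      ENNReal.ofReal (b * (t.card * δ ^ n)) ≤ sigma n (shell E c r ∩ nball (S n) x (21 * R)) := by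
  classical
  obtain ⟨a, -, ha, -, hlow, -⟩ := regular_sigma hn
  obtain ⟨C, hC, hpack⟩ := card_le_of_separated_sphere hn
  refine ⟨a * c ^ n / (C * 36 ^ n), by positivity, fun x hx δ r R hδ hr hrR hR t ht hs => ?_⟩
  have hr0 : 0 < r := hδ.trans_le hr
  have htS : (t : Set (Cn n)) ⊆ S n := fun z hz => hES (ht hz).1
  obtain ⟨F, hFt, hFs, hF⟩ := exists_maximal_separated htS (δ := 36 * r) (by positivity)
    (M := t.card) fun s hst _ => Finset.card_le_card (Finset.coe_subset.mp hst)
  have hFE : ∀ f ∈ F, f ∈ E := fun f hf => (ht (hFt hf)).1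
  have hcard : (t.card : ℝ) ≤ F.card * (C * (36 * r / δ) ^ n) := by
    have hsub : t ⊆ F.biUnion fun f => t.filter fun z => nd z f < 36 * r := fun z hz => by
      obtain ⟨f, hf, hzf⟩ := hF z hz
      exact Finset.mem_biUnion.mpr ⟨f, hf, Finset.mem_filter.mpr ⟨hz, hzf⟩⟩
    calc (t.card : ℝ) ≤ ((F.biUnion fun f => t.filter fun z => nd z f < 36 * r).card : ℝ) := by
          exact_mod_cast Finset.card_le_card hsub
      _ ≤ ∑ f ∈ F, ((t.filter fun z => nd z f < 36 * r).card : ℝ) := by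
          exact_mod_cast Finset.card_biUnion_le
      _ ≤ ∑ f ∈ F, C * (36 * r / δ) ^ n := by
          refine Finset.sum_le_sum fun f hf => ?_
          refine hpack f (hES (hFE f hf)) δ (36 * r) hδ (by linarith) (by linarith) _
            (fun z hz => ?_) (hs.mono (Finset.filter_subset _ _))
          have hz' := Finset.mem_filter.mp (Finset.mem_coe.mp hz)
          exact ⟨htS hz'.1, hz'.2⟩
      _ = _ := by rw [Finset.sum_const, nsmul_eq_mul]
  choose! y hyS hy using fun w (hw : w ∈ E) => hole w hw r hr0 (by linarith)
  have hmeas := hFs.card_mul_le_measure (μ := sigma n) (X := S n) (ρ := 6 * r) S_subset_clB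
    (H := fun f => nball (S n) (y f) (c * r)) (b := a * (c * r) ^ (n : ℝ))
    (A := shell E c r ∩ nball (S n) x (21 * R))
    (fun f hf => hES (hFE f hf)) (by linarith) (fun f => measurableSet_nball measurableSet_S _ _)
    (fun f hf => (hy f (hFE f hf)).trans Set.inter_subset_right)
    (fun f hf => hlow _ (hyS f (hFE f hf)) _ (by positivity) (by nlinarith))
    (fun f hf z hz => by
      have hz' := hy f (hFE f hf) hz
      refine ⟨hz'.1, hz.1, ?_⟩
      have := nd_triangle (S_subset_clB hz.1) (S_subset_clB (hES (hFE f hf)))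
        (S_subset_clB (hES hx))
      linarith [hz'.2.2, (ht (hFt hf)).2])
  refine le_trans ?_ hmeas
  rw [← ENNReal.ofReal_natCast, ← ENNReal.ofReal_mul (by positivity), Real.rpow_natCast]
  apply ENNReal.ofReal_le_ofReal
  calc a * c ^ n / (C * 36 ^ n) * (t.card * δ ^ n)
      ≤ a * c ^ n / (C * 36 ^ n) * ((F.card * (C * (36 * r / δ) ^ n)) * δ ^ n) := by gcongr
    _ = _ := by
      rw [div_pow, mul_pow, mul_pow]
      field_simp

/-- A set satisfying the hole condition has `o(λ⁻ⁿ)` separated points at relative scale `λ`. -/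
theorem UHC.exists_card_le (hn : 1 ≤ n) {E : Set (Cn n)} (hES : E ⊆ S n) (h : UHC E) :
    ∃ l B : ℝ, 0 < l ∧ l ≤ 1 / 2 ∧ 0 < B ∧ ∀ J : ℕ, ∀ x ∈ E, ∀ R : ℝ, 0 < R → R ≤ 1 →
      ∀ t : Finset (Cn n), (t : Set (Cn n)) ⊆ nball E x R → Separated (l ^ J * R) t →
        J * (t.card * (l ^ J) ^ n) ≤ B := by
  obtain ⟨c, hc, hc1, hole⟩ := h.exists_hole hES
  obtain ⟨b, hb, hshell⟩ := card_mul_pow_le_sigma_shell hn hES hc hc1 hole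
  obtain ⟨-, D, -, hD, -, hup⟩ := regular_sigma hn
  -- With this ratio the inner bound c·l^i·R of one shell is the outer bound 6·l^(i+1)·R of the
  -- next, so the shells are disjoint.
  set l := c / 6 with hl
  have hl0 : 0 < l := by positivity
  have hl1 : l ≤ 1 / 2 := by linarith
  refine ⟨l, D * 21 ^ n / b, hl0, hl1, by positivity, fun J x hx R hR hR1 t ht hs => ?_⟩
  have hdisj : ((Finset.range J : Finset ℕ) : Set ℕ).PairwiseDisjoint fun j =>
      shell E c (l ^ j * R) ∩ nball (S n) x (21 * R) := by
    have hlt : ∀ i j : ℕ, i < j → Disjoint (shell E c (l ^ i * R) ∩ nball (S n) x (21 * R))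
        (shell E c (l ^ j * R) ∩ nball (S n) x (21 * R)) := by
      intro i j hij
      refine Set.disjoint_left.mpr fun z hz hz' => ?_
      refine absurd (hz.1.2.1.trans_lt hz'.1.2.2) (not_lt.mpr (ENNReal.ofReal_le_ofReal ?_))
      have h1 : l ^ j ≤ l ^ (i + 1) := pow_le_pow_of_le_one hl0.le (by linarith) hij
      calc 6 * (l ^ j * R) ≤ 6 * (l ^ (i + 1) * R) := by gcongr
        _ = c * (l ^ i * R) := by rw [pow_succ, hl]; ring
    intro i _ j _ hij
    rcases lt_or_gt_of_ne hij with h | h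
    · exact hlt i j h
    · exact (hlt j i h).symm
  have hδ : 0 < l ^ J * R := by positivity
  have hsum : (J : ℝ≥0∞) * ENNReal.ofReal (b * (t.card * (l ^ J * R) ^ n)) ≤
      ENNReal.ofReal (D * (21 * R) ^ (n : ℝ)) := by
    calc (J : ℝ≥0∞) * ENNReal.ofReal (b * (t.card * (l ^ J * R) ^ n))
        = ∑ j ∈ Finset.range J, ENNReal.ofReal (b * (t.card * (l ^ J * R) ^ n)) := by
          rw [Finset.sum_const, Finset.card_range, nsmul_eq_mul]
      _ ≤ ∑ j ∈ Finset.range J, sigma n (shell E c (l ^ j * R) ∩ nball (S n) x (21 * R)) := by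
          refine Finset.sum_le_sum fun j hj => ?_
          refine hshell x hx _ _ R hδ ?_ ?_ hR1 t ht hs
          · have := pow_le_pow_of_le_one hl0.le (by linarith) (Finset.mem_range.mp hj).le
            gcongr
          · exact mul_le_of_le_one_left hR.le (pow_le_one₀ hl0.le (by linarith))
      _ = sigma n (⋃ j ∈ Finset.range J, shell E c (l ^ j * R) ∩ nball (S n) x (21 * R)) :=
          (measure_biUnion_finset hdisj fun j _ => (measurableSet_shell _ _ _).inter
            (measurableSet_nball measurableSet_S _ _)).symm
      _ ≤ sigma n (nball (S n) x (21 * R)) :=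
          measure_mono (Set.iUnion₂_subset fun j _ => Set.inter_subset_right)
      _ ≤ _ := hup x (hES hx) _ (by positivity)
  rw [← ENNReal.ofReal_natCast, ← ENNReal.ofReal_mul (by positivity),
    ENNReal.ofReal_le_ofReal_iff (by positivity), Real.rpow_natCast, mul_pow, mul_pow] at hsum
  rw [le_div_iff₀ hb]
  have hRn : 0 < R ^ n := by positivity
  refine le_of_mul_le_mul_right ?_ hRn
  linarith

/-- Iteration of a one-scale bound: each refinement by the factor k multiplies the number of balls
by at most M. -/
theorem exists_cover_of_card_le {E : Set (Cn n)} (hES : E ⊆ S n) {k M : ℝ} (hk : 1 ≤ k)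
    (hM : 0 ≤ M)
    (h : ∀ x ∈ E, ∀ R : ℝ, 0 < R → R ≤ 1 → ∀ t : Finset (Cn n), (t : Set (Cn n)) ⊆ nball E x R →
      Separated (R / k) t → (t.card : ℝ) ≤ M) (j : ℕ) :
    ∀ x ∈ E, ∀ R : ℝ, 0 < R → R ≤ 1 → ∃ F : Finset (Cn n), (F : Set (Cn n)) ⊆ E ∧
      (F.card : ℝ) ≤ M ^ j ∧ ∀ z ∈ nball E x R, ∃ f ∈ F, nd z f < R / k ^ j := by
  classical
  have hk0 : 0 < k := by linarith
  intro x hx R hR hR1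
  induction j with
  | zero => exact ⟨{x}, by simpa using hx, by simp, fun z hz => ⟨x, by simp, by simpa using hz.2⟩⟩
  | succ j ih =>
    obtain ⟨F, hFE, hFc, hF⟩ := ih
    have hnet : ∀ f ∈ F, ∃ G : Finset (Cn n), (G : Set (Cn n)) ⊆ E ∧ (G.card : ℝ) ≤ M ∧
        ∀ z ∈ nball E f (R / k ^ j), ∃ g ∈ G, nd z g < R / k ^ (j + 1) := by
      intro f hf
      have hle : R / k ^ j ≤ 1 := (div_le_self hR.le (one_le_pow₀ hk)).trans hR1
      obtain ⟨G, hG, -, hGc, hGn⟩ := exists_separated_net hES (fun z hz => hz.1) (by positivity)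
        (h f (hFE hf) (R / k ^ j) (by positivity) hle)
      refine ⟨G, fun z hz => (hG hz).1, hGc, ?_⟩
      rwa [div_div, ← pow_succ] at hGn
    choose! G hGE hGc hG using hnet
    refine ⟨F.biUnion G, fun z hz => ?_, ?_, fun z hz => ?_⟩
    · obtain ⟨f, hf, hz⟩ := Finset.mem_biUnion.mp (Finset.mem_coe.mp hz)
      exact hGE f hf hz
    · calc ((F.biUnion G).card : ℝ) ≤ ∑ f ∈ F, ((G f).card : ℝ) := by
            exact_mod_cast Finset.card_biUnion_le
        _ ≤ ∑ f ∈ F, M := Finset.sum_le_sum hGc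
        _ = F.card * M := by rw [Finset.sum_const, nsmul_eq_mul]
        _ ≤ M ^ j * M := by gcongr
        _ = _ := (pow_succ _ _).symm
    · obtain ⟨f, hf, hzf⟩ := hF z hz
      obtain ⟨g, hg, hzg⟩ := hG f hf z ⟨hz.1, hzf⟩
      exact ⟨g, Finset.mem_biUnion.mpr ⟨f, hf, hg⟩, hzg⟩

theorem inUpsilon_of_card_le {E : Set (Cn n)} (hES : E ⊆ S n) {k γ : ℝ} (hk : 1 < k) (hγ : 0 ≤ γ)
    (h : ∀ x ∈ E, ∀ R : ℝ, 0 < R → R ≤ 1 → ∀ t : Finset (Cn n), (t : Set (Cn n)) ⊆ nball E x R →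
      Separated (R / k) t → (t.card : ℝ) ≤ k ^ γ) : InUpsilon E γ := by
  have hk0 : 0 < k := by linarith
  refine ⟨(6 * k) ^ γ, by positivity, fun x hx δ q hδ hq hq1 => ?_⟩
  have hq0 : 0 < q := pos_of_mul_pos_left (hδ.trans_le hq) hδ.le
  have hq1' : 1 ≤ q := le_of_mul_le_mul_right (by linarith) hδ
  refine packing_le_ofReal (by positivity) fun t ht hs => ?_
  -- From k^i ≤ 6q < k^(i+1) the covering radius is below δ/6, so each covering ball holds at most
  -- one point of t, while the count stays below (6kq)^γ.
  obtain ⟨i, hi, hi'⟩ := exists_nat_pow_near (x := 6 * q) (by linarith) hk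
  obtain ⟨F, hFE, hFc, hF⟩ := exists_cover_of_card_le hES hk.le (by positivity) h (i + 1) x hx
    (q * δ) (by positivity) hq1
  choose! φ hφF hφ using hF
  have hinj : Set.InjOn φ (t : Set (Cn n)) := by
    intro z hz w hw hzw
    by_contra hne
    have h1 := hs hz hw hne
    have h2 := nd_triangle (S_subset_clB (hES (ht hz).1))
      (S_subset_clB (hES (hFE (hφF z (ht hz))))) (S_subset_clB (hES (ht hw).1))
    have h3 := hφ z (ht hz)
    have h4 := hφ w (ht hw)
    rw [← hzw, nd_comm] at h4
    have h5 : q * δ / k ^ (i + 1) < δ / 6 := by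
      rw [div_lt_iff₀ (by positivity)]
      nlinarith
    linarith
  have hle : t.card ≤ F.card := Finset.card_le_card_of_injOn φ (fun z hz => hφF z (ht hz)) hinj
  calc (t.card : ℝ) ≤ F.card := by exact_mod_cast hle
    _ ≤ (k ^ γ) ^ (i + 1) := hFc
    _ = (k * k ^ i) ^ γ := by
        rw [← pow_succ', ← Real.rpow_natCast, ← Real.rpow_natCast, ← Real.rpow_mul hk0.le,
          ← Real.rpow_mul hk0.le, mul_comm]
    _ ≤ (k * (6 * q)) ^ γ := by gcongr
    _ = (6 * k) ^ γ * q ^ γ := by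
        rw [← Real.mul_rpow (by positivity) hq0.le]
        ring_nf

theorem UHC.exists_inUpsilon (hn : 1 ≤ n) {E : Set (Cn n)} (hES : E ⊆ S n) (h : UHC E) :
    ∃ γ : ℝ, γ < n ∧ InUpsilon E γ := by
  obtain ⟨l, B, hl, hl2, hB, hcard⟩ := h.exists_card_le hn hES
  -- J ≥ 2B makes the count at ratio k = l^(-J) at most k^n/2, which is k^γ for γ = n - log 2/log k;
  -- k ≥ 2 keeps γ nonnegative.
  obtain ⟨J, hJ⟩ := exists_nat_ge (max (2 * B) 1)
  have hJB : 2 * B ≤ J := (le_max_left _ _).trans hJ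
  have hJ1 : (1 : ℝ) ≤ J := (le_max_right _ _).trans hJ
  have hJ1' : 1 ≤ J := by exact_mod_cast hJ1
  have hn' : (1 : ℝ) ≤ n := by exact_mod_cast hn
  set k : ℝ := (l ^ J)⁻¹ with hk
  have hk2 : 2 ≤ k := by
    rw [hk, le_inv_comm₀ two_pos (by positivity)]
    calc l ^ J ≤ l ^ 1 := pow_le_pow_of_le_one hl.le (by linarith) hJ1'
      _ ≤ 2⁻¹ := by rw [pow_one]; linarith
  have hlogk : Real.log 2 ≤ Real.log k := Real.log_le_log two_pos hk2
  have hlog2 : 0 < Real.log 2 := Real.log_pos one_lt_two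
  have hlogk0 : 0 < Real.log k := by linarith
  have hle1 : Real.log 2 / Real.log k ≤ 1 := (div_le_one hlogk0).mpr hlogk
  have hpos : 0 < Real.log 2 / Real.log k := by positivity
  have hk0 : 0 < k := by linarith
  refine ⟨n - Real.log 2 / Real.log k, by linarith,
    inUpsilon_of_card_le hES (k := k) (by linarith) (by linarith) fun x hx R hR hR1 t ht hs => ?_⟩
  have hkγ : k ^ ((n : ℝ) - Real.log 2 / Real.log k) = k ^ n / 2 := by
    rw [Real.rpow_sub hk0, Real.rpow_natCast]
    congr 1
    rw [Real.rpow_def_of_pos hk0, mul_div_cancel₀ _ hlogk0.ne', Real.exp_log two_pos]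
  have h1 := hcard J x hx R hR hR1 t ht (by rwa [hk, div_inv_eq_mul, mul_comm] at hs)
  have hp : 0 < (l ^ J) ^ n := by positivity
  rw [hkγ, hk, inv_pow, inv_eq_one_div, div_div, le_div_iff₀ (by positivity)]
  refine le_of_mul_le_mul_left ?_ (by linarith : (0 : ℝ) < J)
  linarith

-- Volume integrals and the assembled equivalence.

/-- Markov's inequality for d(z,E)^(-a) with some a > 1, which gives s = n + 1 - a < n. -/
theorem volumeBound_of_volumeIntegralBound {E : Set (Cn n)} (hES : E ⊆ S n)
    (h : VolumeIntegralBound E) : VolumeBound E := by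
  obtain ⟨a₀, ha₀, h⟩ := h
  obtain ⟨a, ha1, ha2⟩ := exists_between ha₀
  have ha : 0 < a := by linarith
  obtain ⟨C, hC, h⟩ := h a ha.le ha2
  refine ⟨n + 1 - a, C, by linarith, hC, fun x hx R ε hε hεR => ?_⟩
  have hR : 0 < R := hε.trans hεR
  have hm : MeasurableSet (nball (clB n) x R ∩ nbhd (clB n) E ε) :=
    (measurableSet_nball measurableSet_clB x R).inter (measurableSet_nbhd measurableSet_clB E ε)
  have h1 : ENNReal.ofReal (ε ^ (-a)) * V n (nball (clB n) x R ∩ nbhd (clB n) E ε) ≤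
      ENNReal.ofReal (C * R ^ ((n : ℝ) + 1 - a)) := by
    rw [← setLIntegral_const]
    refine le_trans ?_ (h x (hES hx) R hR)
    refine le_trans ?_ (lintegral_mono_set (Set.inter_subset_left (t := nbhd (clB n) E ε)))
    refine setLIntegral_mono' hm fun z hz => ?_
    rw [← ENNReal.ofReal_rpow_of_pos hε, ENNReal.rpow_neg, ENNReal.rpow_neg, ENNReal.inv_le_inv]
    exact ENNReal.rpow_le_rpow hz.2.2.le ha.le
  have e : (1 : ℝ≥0∞) = ENNReal.ofReal (ε ^ a) * ENNReal.ofReal (ε ^ (-a)) := by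
    rw [← ENNReal.ofReal_mul (by positivity), ← Real.rpow_add hε]
    simp
  calc V n (nball (clB n) x R ∩ nbhd (clB n) E ε)
      = ENNReal.ofReal (ε ^ a) *
        (ENNReal.ofReal (ε ^ (-a)) * V n (nball (clB n) x R ∩ nbhd (clB n) E ε)) := by
        rw [← mul_assoc, ← e, one_mul]
    _ ≤ ENNReal.ofReal (ε ^ a) * ENNReal.ofReal (C * R ^ ((n : ℝ) + 1 - a)) := by gcongr
    _ = _ := by
        rw [← ENNReal.ofReal_mul (by positivity)]
        congr 1
        rw [sub_sub_cancel]
        ring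

end NonIso

open NonIso

theorem theorem2 (n : ℕ) (hn : 1 ≤ n) (E : Set (NonIso.Cn n)) (hES : E ⊆ NonIso.S n)
    (hE : IsClosed E) :
    List.TFAE [
      NonIso.UHC E,
      ∃ s : ℝ, s < n ∧ NonIso.SigmaCond E s,
      NonIso.upperDim E < ((n : ℝ) : EReal),
      NonIso.PowerIntegralBound E,
      NonIso.LogIntegralBound E,
      NonIso.PackingIntegralBound E,
      NonIso.VolumeBound E,
      NonIso.VolumeIntegralBound E] := by
  have hσ := regular_sigma hn
  have hV := regular_V hn
  tfae_have 1 → 3 := fun h =>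
    let ⟨_, hγ, hU⟩ := h.exists_inUpsilon hn hES
    upperDim_lt_of_inUpsilon hγ hU
  tfae_have 3 → 2 := fun h => by
    obtain ⟨γ, C, -, hγ, hC, hP⟩ := exists_packingBound_of_upperDim_lt hn hES hE h
    exact ⟨γ, hγ, measure_nbhd_le_of_packingBound hES S_subset_clB hσ hC hP⟩
  tfae_have 2 → 4 := by
    rintro ⟨s, hs, C, hC, h⟩
    have ha : 0 < ((n : ℝ) - s) / 2 := by linarith
    obtain ⟨C', hC', h'⟩ := lintegral_ndSet_rpow_le hσ hC h ha.le (by linarith)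
    exact ⟨_, C', ha, hC', h'⟩
  tfae_have 4 → 5 := logIntegralBound_of_powerIntegralBound hn
  tfae_have 5 → 1 := uhc_of_logIntegralBound hn
  tfae_have 3 → 6 := fun h => by
    obtain ⟨γ, C, hγ0, hγ, hC, hP⟩ := exists_packingBound_of_upperDim_lt hn hES hE h
    exact packingIntegralBound_of_packingBound hn hγ0 hγ hC hP
  tfae_have 6 → 3 := fun h =>
    let ⟨_, hγ, hU⟩ := h.exists_inUpsilon
    upperDim_lt_of_inUpsilon hγ hU
  tfae_have 7 → 3 := by
    rintro ⟨s, C, hs, hC, h⟩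
    exact upperDim_lt_of_inUpsilon hs
      (inUpsilon_of_measure_nbhd_le hES subset_rfl measurableSet_clB hV hC h)
  tfae_have 3 → 8 := fun h => by
    obtain ⟨γ, C, -, hγ, hC, hP⟩ := exists_packingBound_of_upperDim_lt hn hES hE h
    obtain ⟨C', hC', h'⟩ := measure_nbhd_le_of_packingBound hES subset_rfl hV hC hP
    -- The threshold n + 1 - γ exceeds 1 precisely because γ < n.
    exact ⟨n + 1 - γ, by linarith, fun a ha ha' => lintegral_ndSet_rpow_le hV hC' h' ha ha'⟩
  tfae_have 8 → 7 := volumeBound_of_volumeIntegralBound hES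
  tfae_finish
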